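/- Let $H\in(1/2,1)$, let $(\Omega,\mathcal F,\mathbb F=\{\mathcal F_t\}_{t\in[0,1]},P)$ be a stochastic basis, and let $B^H=\{B^H(t),\,t\in[0,1]\}$ be a fractional Brownian motion on it with Hurst parameter $H$, i.e. an $\mathbb F$-adapted centered Gaussian process with continuous paths and $\mathbb E\,B^H(t)B^H(s)=\frac12\left(s^{2H}+t^{2H}-|s-t|^{2H}\right)$ for $s,t\in[0,1]$. For $\beta\in(0,1)$ and $f,g\colon[a,b]\to\mathbb R$ put, for $x\in(a,b)$, $$\big(D_{a+}^{\beta}f\big)(x)=\frac{1}{\Gamma(1-\beta)}\left(\frac{f(x)}{(x-a)^\beta}+\beta\int_a^x\frac{f(x)-f(u)}{(x-u)^{1+\beta}}\,du\right),$$ $$\big(\widetilde D_{b-}^{1-\beta}g\big)(x)=\frac{1}{\Gamma(\beta)}\left(\frac{g(x)}{(b-x)^{1-\beta}}+(1-\beta)\int_x^b\frac{g(x)-g(u)}{(u-x)^{2-\beta}}\,du\right),$$ and $g_{b-}(x)=g(x)-g(b-)$. The generalized Lebesgue--Stieltjes integral is $$\int_a^b f\,dg=-\int_a^b\big(D_{a+}^{\beta}f\big)(x)\,\big(\widetilde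 D_{b-}^{1-\beta}g_{b-}\big)(x)\,dx ;$$ it exists if both derivatives exist for a.e. $x\in(a,b)$ and the product is integrable on $(a,b)$. (The minus sign is the product of the usual factors $(-1)^{\beta}$ and $(-1)^{1-\beta}$.) Put $$\|f\|_{\beta,t}=\int_0^t\left(\frac{|f(s)|}{s^\beta}+\int_0^s\frac{|f(s)-f(z)|}{(s-z)^{1+\beta}}\,dz\right)ds .$$ Then for every $\eta\in(0,\frac1H-1)$ there is an $\mathbb F$-adapted process $\phi=\{\phi(t),\,t\in[0,1]\}$ with continuous paths on $[0,1]$ such that $\phi(0)=0$, $|\phi(t)|\le 1+\eta$ for all $t\in[0,1]$, and, for every $\beta\in(1-H,\frac12)$, almost surely: for every $t\in[0,1)$ one has $\|\phi\|_{\beta,t}<\infty$ and the integral $\int_0^t\phi(s)\,dB^H(s)$ exists, and $$\lim_{t\to1-}\int_0^t\phi(s)\,dB^H(s)=+\infty .$$ -/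

import Mathlib

open MeasureTheory ProbabilityTheory Set Filter Topology
open scoped ENNReal

noncomputable section

/-- `B` is a fractional Brownian motion with Hurst parameter `H` on the stochastic basis
`(Ω, m, ℱ, P)`, time running over `[0,1]`: an `ℱ`-adapted centered Gaussian process with continuous
paths and the fractional covariance function. -/
structure IsFractionalBrownianMotion {Ω : Type*} {m : MeasurableSpace Ω} (P : Measure Ω)
    (ℱ : Filtration (Icc (0 : ℝ) 1) m) (H : ℝ) (B : Icc (0 : ℝ) 1 → Ω → ℝ) : Prop where
  adapted : Adapted ℱ B
  gaussian : IsGaussianProcess B P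
  centered : ∀ t, ∫ ω, B t ω ∂P = 0
  covariance : ∀ s t : Icc (0 : ℝ) 1, ∫ ω, B t ω * B s ω ∂P =
    ((s : ℝ) ^ (2 * H) + (t : ℝ) ^ (2 * H) - |(s : ℝ) - (t : ℝ)| ^ (2 * H)) / 2
  continuous_path : ∀ ω, Continuous fun t => B t ω

/-- The path `t ↦ X t ω` of a process on `[0,1]`, as a function on `ℝ` (constant on either side of
`[0,1]`; these values are never used by the integrals over subintervals of `[0,1]`). -/
def samplePath {Ω : Type*} (X : Icc (0 : ℝ) 1 → Ω → ℝ) (ω : Ω) : ℝ → ℝ :=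
  IccExtend (zero_le_one' ℝ) fun t => X t ω

/-- Forward Riemann–Liouville fractional derivative `D_{a+}^β f`, in Weyl form. -/
def forwardDeriv (β a : ℝ) (f : ℝ → ℝ) (x : ℝ) : ℝ :=
  1 / Real.Gamma (1 - β) *
    (f x / (x - a) ^ β + β * ∫ u in Ioo a x, (f x - f u) / (x - u) ^ (1 + β))

/-- Backward Riemann–Liouville fractional derivative `D_{b-}^{1-β} g`, in Weyl form, without its
unimodular constant factor `(-1)^(1-β) = e^{iπ(1-β)}`. -/
def backwardDeriv (β b : ℝ) (g : ℝ → ℝ) (x : ℝ) : ℝ :=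
  1 / Real.Gamma β *
    (g x / (b - x) ^ (1 - β) + (1 - β) * ∫ u in Ioo x b, (g x - g u) / (u - x) ^ (2 - β))

/-- `g_{b-}(x) = g(x) - g(b-)`. -/
def leftCentered (b : ℝ) (g : ℝ → ℝ) (x : ℝ) : ℝ :=
  g x - Function.leftLim g b

/-- Existence of the generalized Lebesgue–Stieltjes integral `∫_a^b f dg` of order `β`: the two
fractional derivatives exist almost everywhere on `(a,b)` and their product is integrable. -/
structure GLSIntegrable (β : ℝ) (f g : ℝ → ℝ) (a b : ℝ) : Prop where
  forward : ∀ᵐ x ∂(volume.restrict (Ioo a b)),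
    IntegrableOn (fun u => (f x - f u) / (x - u) ^ (1 + β)) (Ioo a x)
  backward : ∀ᵐ x ∂(volume.restrict (Ioo a b)),
    IntegrableOn (fun u => (leftCentered b g x - leftCentered b g u) / (u - x) ^ (2 - β)) (Ioo x b)
  mul : IntegrableOn
    (fun x => forwardDeriv β a f x * backwardDeriv β b (leftCentered b g) x) (Ioo a b)

/-- The generalized Lebesgue–Stieltjes integral
`∫_a^b f dg = (-1)^β ∫_a^b (D_{a+}^β f)(x) (D_{b-}^{1-β} g_{b-})(x) dx`. The constants `(-1)^β` and
`(-1)^(1-β)` (the latter left out of `backwardDeriv`) multiply to `e^{iπ} = -1`. -/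
def glsIntegral (β : ℝ) (f g : ℝ → ℝ) (a b : ℝ) : ℝ :=
  -∫ x in Ioo a b, forwardDeriv β a f x * backwardDeriv β b (leftCentered b g) x

/-- The norm `‖f‖_{β,[a,b]}`, with value in `[0,∞]`; functions for which it is finite are the
admissible integrands. -/
def glsNorm (β : ℝ) (f : ℝ → ℝ) (a b : ℝ) : ℝ≥0∞ :=
  ∫⁻ s in Ioo a b, (ENNReal.ofReal (|f s| / (s - a) ^ β) +
    ∫⁻ z in Ioo a s, ENNReal.ofReal (|f s - f z| / (s - z) ^ (1 + β)))

end

/-! Paths of Hölder order above `1/2` obey ordinary calculus: over a cell `[s,e]` the integrand `sin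
((B r - B s) / σ)` integrates to `σ (1 - cos ((B e - B s) / σ))`, which is never negative. Cut
`[0,1)` into the blocks `[1 - 2^(-k), 1 - 2^(-k-1)]` and the `k`-th block into `N k` cells of length
`δ`, with `σ = δ^H` the standard deviation of an increment. With amplitude `2^(-k-1)` the block
gains about `2^(-k-1) δ^H N k`, which for fixed `k` is of order `(N k)^(1-H)`. Since `H < 1`, enough
cells outweigh the small amplitude and every block can gain a fixed amount. The amplitudes sum to
`1`, which gives both the bound on `φ` and, by uniform convergence, continuity up to time `1`.

The gains are realised almost surely by Chebyshev and Borel–Cantelli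
(`measureReal_sum_one_sub_cos_lt`). For `H ≥ 1/2` increments are nonnegatively correlated, and
passing to cosines does not increase the covariance; the covariances of the increments themselves
telescope to `N^(2H)`, which is small against `N^2`.

The cell integrand jumps at cell ends, so it is replaced by its mean over the preceding window of
length `h k`; this keeps it adapted and makes it Lipschitz. Before time `1` only finitely many
blocks are active, so `φ` is a primitive of a bounded density and its integral is given by
integration by parts (`gls_of_primitive`). Translating the density turns this into a forward
integral with difference quotients `(g (r + h) - g r) / h` (`integral_density_eq_forward_integral`).
A Taylor estimate compares that with the exact gain (`abs_forward_integral_cell_sub_le`); choosing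
`h k` after `N k` makes the errors summable in `k`. -/

/-! ### Hölder continuity from dyadic increments. -/

theorem natFloor_two_mul_or (a : ℝ) (ha : 0 ≤ a) :
    ⌊2 * a⌋₊ = 2 * ⌊a⌋₊ ∨ ⌊2 * a⌋₊ = 2 * ⌊a⌋₊ + 1 := by
  have h1 := Nat.floor_le ha
  have h2 := Nat.lt_floor_add_one a
  have h3 : 2 * ⌊a⌋₊ ≤ ⌊2 * a⌋₊ := Nat.le_floor (by push_cast; linarith)
  have h4 : ⌊2 * a⌋₊ < 2 * ⌊a⌋₊ + 2 := (Nat.floor_lt (by linarith)).2 (by push_cast; linarith)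
  omega

/-- A continuous function whose dyadic increments are controlled is Hölder continuous. -/
theorem holder_of_forall_dyadic {f : ℝ → ℝ} (hf : Continuous f) {lam K : ℝ} (hl : 0 < lam)
    (hK : 0 ≤ K)
    (h : ∀ n j : ℕ, j < 2 ^ n →
      |f ((j + 1) / 2 ^ n) - f (j / 2 ^ n)| ≤ K * ((1 / 2 : ℝ) ^ lam) ^ n) :
    ∃ C : ℝ, 0 ≤ C ∧ ∀ x ∈ Icc (0 : ℝ) 1, ∀ y ∈ Icc (0 : ℝ) 1,
      |f x - f y| ≤ C * |x - y| ^ lam := by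
  set q : ℝ := (1 / 2 : ℝ) ^ lam with hq
  have hq0 : 0 < q := by positivity
  have hq1 : q < 1 := Real.rpow_lt_one (by norm_num) (by norm_num) hl
  -- Chaining: consecutive dyadic approximations of `x` from below coincide or are neighbours at the
  -- finer level, so the error is a geometric tail.
  have approx : ∀ x ∈ Icc (0 : ℝ) 1, ∀ n : ℕ,
      |f (⌊x * 2 ^ n⌋₊ / 2 ^ n) - f x| ≤ K * q ^ n / (1 - q) := by
    intro x hx n
    refine dist_le_of_le_geometric_of_tendsto (f := fun n : ℕ => f (⌊x * 2 ^ n⌋₊ / 2 ^ n)) q K hq1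
      (fun n => ?_) ?_ n
    · have hx0 : 0 ≤ x * 2 ^ n := mul_nonneg hx.1 (by positivity)
      have e : x * 2 ^ (n + 1) = 2 * (x * 2 ^ n) := by ring
      rw [Real.dist_eq, abs_sub_comm]
      rcases natFloor_two_mul_or _ hx0 with h' | h'
      · rw [e, h']
        have : ((2 * ⌊x * 2 ^ n⌋₊ : ℕ) : ℝ) / 2 ^ (n + 1) = (⌊x * 2 ^ n⌋₊ : ℝ) / 2 ^ n := by
          push_cast; field_simp; ring
        rw [this, sub_self, abs_zero]; positivity
      · have hlt : 2 * ⌊x * 2 ^ n⌋₊ < 2 ^ (n + 1) := by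
          have : ⌊2 * (x * 2 ^ n)⌋₊ ≤ 2 ^ (n + 1) := by
            refine Nat.floor_le_of_le ?_
            push_cast
            nlinarith [hx.2, pow_pos (two_pos : (0 : ℝ) < 2) n, pow_succ (2 : ℝ) n]
          omega
        have := h (n + 1) _ hlt
        rw [e, h']
        have e2 : ((2 * ⌊x * 2 ^ n⌋₊ : ℕ) : ℝ) / 2 ^ (n + 1) = (⌊x * 2 ^ n⌋₊ : ℝ) / 2 ^ n := by
          push_cast; field_simp; ring
        rw [e2] at this
        push_cast at this ⊢
        refine this.trans ?_
        rw [pow_succ]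
        exact mul_le_mul_of_nonneg_left (mul_le_of_le_one_right (by positivity) hq1.le) hK
    · refine (hf.tendsto x).comp ?_
      have h2 : Tendsto (fun n : ℕ => (2 : ℝ) ^ n) atTop atTop :=
        tendsto_pow_atTop_atTop_of_one_lt (by norm_num)
      exact (tendsto_nat_floor_mul_div_atTop hx.1).comp h2
  refine ⟨(2 * (K / (1 - q)) + K) / q, ?_, ?_⟩
  · have : 0 < 1 - q := by linarith
    positivity
  have main : ∀ x ∈ Icc (0 : ℝ) 1, ∀ y ∈ Icc (0 : ℝ) 1, x < y →
      |f x - f y| ≤ (2 * (K / (1 - q)) + K) / q * |x - y| ^ lam := by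
    intro x hx y hy hxy
    -- The level at which `2^(-(n+1)) < y - x ≤ 2^(-n)`: the approximations of `x` and `y` are then
    -- equal or adjacent, and `q^(n+1)` is below `|x - y|^lam`.
    obtain ⟨n, hn1, hn2⟩ := exists_nat_pow_near_of_lt_one (x := y - x) (y := (1 / 2 : ℝ))
      (by linarith) (by linarith [hx.1, hy.2]) (by norm_num) (by norm_num)
    have hx0 : 0 ≤ x * 2 ^ n := mul_nonneg hx.1 (by positivity)
    have hyx : y * 2 ^ n ≤ x * 2 ^ n + 1 := by
      have : (y - x) * 2 ^ n ≤ (1 / 2) ^ n * 2 ^ n := by gcongr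
      rw [← mul_pow] at this
      norm_num at this
      linarith
    have hmid : |f (⌊x * 2 ^ n⌋₊ / 2 ^ n) - f (⌊y * 2 ^ n⌋₊ / 2 ^ n)| ≤ K * q ^ n := by
      have l1 : ⌊x * 2 ^ n⌋₊ ≤ ⌊y * 2 ^ n⌋₊ := by gcongr
      have l2 : ⌊y * 2 ^ n⌋₊ ≤ ⌊x * 2 ^ n⌋₊ + 1 := by
        have := Nat.floor_le_floor hyx
        rwa [Nat.floor_add_one hx0] at this
      rcases Nat.lt_or_ge ⌊x * 2 ^ n⌋₊ ⌊y * 2 ^ n⌋₊ with h' | h'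
      · have e : ⌊y * 2 ^ n⌋₊ = ⌊x * 2 ^ n⌋₊ + 1 := by omega
        have hle : ⌊y * 2 ^ n⌋₊ ≤ 2 ^ n := by
          refine Nat.floor_le_of_le ?_
          push_cast
          nlinarith [hy.2, pow_pos (two_pos : (0 : ℝ) < 2) n]
        have := h n ⌊x * 2 ^ n⌋₊ (by omega)
        rw [e, abs_sub_comm]
        push_cast
        exact this
      · rw [le_antisymm l1 h', sub_self, abs_zero]; positivity
    have hxa := approx x hx n
    have hya := approx y hy n
    have tri : |f x - f y| ≤ (2 * (K / (1 - q)) + K) * q ^ n := by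
      rw [abs_sub_comm] at hxa
      have e : f x - f y = (f x - f (⌊x * 2 ^ n⌋₊ / 2 ^ n)) +
        ((f (⌊x * 2 ^ n⌋₊ / 2 ^ n) - f (⌊y * 2 ^ n⌋₊ / 2 ^ n)) +
          (f (⌊y * 2 ^ n⌋₊ / 2 ^ n) - f y)) := by ring
      calc |f x - f y| ≤ K * q ^ n / (1 - q) + (K * q ^ n + K * q ^ n / (1 - q)) := by
            rw [e]
            refine (abs_add_le _ _).trans (add_le_add hxa ?_)
            exact (abs_add_le _ _).trans (add_le_add hmid hya)
        _ = _ := by ring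
    have hqn : q ^ (n + 1) ≤ |x - y| ^ lam := by
      rw [hq, ← Real.rpow_natCast, ← Real.rpow_mul (by norm_num), mul_comm,
        Real.rpow_mul (by norm_num), Real.rpow_natCast, abs_sub_comm, abs_of_pos (by linarith)]
      exact Real.rpow_le_rpow (by positivity) hn1.le hl.le
    have hc : 0 ≤ 2 * (K / (1 - q)) + K := by
      have : 0 < 1 - q := by linarith
      positivity
    calc |f x - f y| ≤ (2 * (K / (1 - q)) + K) / q * q ^ (n + 1) := by
          have e : (2 * (K / (1 - q)) + K) / q * q ^ (n + 1) = (2 * (K / (1 - q)) + K) * q ^ n := by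
            rw [pow_succ]; field_simp
          rw [e]; exact tri
      _ ≤ _ := by gcongr
  intro x hx y hy
  rcases lt_trichotomy x y with h' | h' | h'
  · exact main x hx y hy h'
  · rw [h', sub_self, abs_zero, sub_self, abs_zero, Real.zero_rpow hl.ne', mul_zero]
  · rw [abs_sub_comm, abs_sub_comm x y]; exact main y hy x hx h'

/-- The finitely many coarse levels cost only a larger constant, because `f` is bounded on `[0,1]`.
This is the form that Borel–Cantelli supplies. -/
theorem holder_of_eventually_dyadic {f : ℝ → ℝ} (hf : Continuous f) {lam : ℝ} (hl : 0 < lam)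
    (h : ∀ᶠ n : ℕ in atTop, ∀ j : ℕ, j < 2 ^ n →
      |f ((j + 1) / 2 ^ n) - f (j / 2 ^ n)| ≤ ((1 / 2 : ℝ) ^ lam) ^ n) :
    ∃ C : ℝ, 0 ≤ C ∧ ∀ x ∈ Icc (0 : ℝ) 1, ∀ y ∈ Icc (0 : ℝ) 1,
      |f x - f y| ≤ C * |x - y| ^ lam := by
  obtain ⟨n₀, hn₀⟩ := eventually_atTop.1 h
  obtain ⟨M, hM⟩ := (isCompact_Icc (a := (0 : ℝ)) (b := 1)).exists_bound_of_continuousOn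
    hf.continuousOn
  set q : ℝ := (1 / 2 : ℝ) ^ lam with hq
  have hq0 : 0 < q := by positivity
  have hq1 : q < 1 := Real.rpow_lt_one (by norm_num) (by norm_num) hl
  have hM0 : 0 ≤ M := (norm_nonneg _).trans (hM 0 (by simp))
  refine holder_of_forall_dyadic hf hl (K := max 1 (2 * M / q ^ n₀)) (by positivity) ?_
  intro n j hj
  rcases le_or_gt n₀ n with hn | hn
  · exact (hn₀ n hn j hj).trans (le_mul_of_one_le_left (by positivity) (le_max_left _ _))
  · have hp : (0 : ℝ) < 2 ^ n := by positivity
    have hj' : (j : ℝ) + 1 ≤ 2 ^ n := by exact_mod_cast hj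
    have m1 : ((j : ℝ) + 1) / 2 ^ n ∈ Icc (0 : ℝ) 1 :=
      ⟨by positivity, by rw [div_le_one hp]; exact hj'⟩
    have m2 : (j : ℝ) / 2 ^ n ∈ Icc (0 : ℝ) 1 :=
      ⟨by positivity, by rw [div_le_one hp]; linarith⟩
    calc _ ≤ ‖f ((j + 1) / 2 ^ n)‖ + ‖f (j / 2 ^ n)‖ := norm_sub_le _ _
      _ ≤ 2 * M := by linarith [hM _ m1, hM _ m2]
      _ = 2 * M / q ^ n₀ * q ^ n₀ := by field_simp
      _ ≤ max 1 (2 * M / q ^ n₀) * q ^ n :=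
          mul_le_mul (le_max_right _ _) (pow_le_pow_of_le_one hq0.le hq1.le hn.le)
            (by positivity) (by positivity)

/-! ### Second moments of the increments. -/

namespace IsFractionalBrownianMotion

variable {Ω : Type*} {m : MeasurableSpace Ω} {P : Measure Ω}
  {ℱ : Filtration (Icc (0 : ℝ) 1) m} {H : ℝ} {B : Icc (0 : ℝ) 1 → Ω → ℝ}

theorem continuous_samplePath (hB : IsFractionalBrownianMotion P ℱ H B) (ω : Ω) :
    Continuous (samplePath B ω) :=
  (hB.continuous_path ω).Icc_extend'

theorem isGaussianProcess_samplePath (hB : IsFractionalBrownianMotion P ℱ H B) :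
    IsGaussianProcess (fun (t : ℝ) ω => samplePath B ω t) P :=
  hB.gaussian.comp_right (projIcc 0 1 zero_le_one)

theorem hasGaussianLaw_increment (hB : IsFractionalBrownianMotion P ℱ H B) (s t : ℝ) :
    HasGaussianLaw (fun ω => samplePath B ω t - samplePath B ω s) P :=
  hB.isGaussianProcess_samplePath.hasGaussianLaw_fun_sub

theorem memLp_two (hB : IsFractionalBrownianMotion P ℱ H B) (t : ℝ) :
    MemLp (fun ω => samplePath B ω t) 2 P :=
  (hB.isGaussianProcess_samplePath.hasGaussianLaw_eval t).memLp_two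

theorem integrable (hB : IsFractionalBrownianMotion P ℱ H B) (t : ℝ) :
    Integrable (fun ω => samplePath B ω t) P :=
  (hB.isGaussianProcess_samplePath.hasGaussianLaw_eval t).integrable

theorem integrable_mul (hB : IsFractionalBrownianMotion P ℱ H B) (s t : ℝ) :
    Integrable (fun ω => samplePath B ω s * samplePath B ω t) P :=
  (hB.memLp_two s).integrable_mul (hB.memLp_two t)

theorem integral_increment (hB : IsFractionalBrownianMotion P ℱ H B) (s t : ℝ) :
    ∫ ω, (samplePath B ω t - samplePath B ω s) ∂P = 0 := by
  rw [integral_sub (hB.integrable t) (hB.integrable s)]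
  simp only [samplePath, IccExtend, Function.comp_apply, hB.centered, sub_self]

theorem integral_mul (hB : IsFractionalBrownianMotion P ℱ H B) {s t : ℝ} (hs : s ∈ Icc (0 : ℝ) 1)
    (ht : t ∈ Icc (0 : ℝ) 1) : ∫ ω, samplePath B ω t * samplePath B ω s ∂P =
      (s ^ (2 * H) + t ^ (2 * H) - |s - t| ^ (2 * H)) / 2 := by
  simpa only [samplePath, IccExtend_of_mem _ _ hs, IccExtend_of_mem _ _ ht] using
    hB.covariance ⟨s, hs⟩ ⟨t, ht⟩

theorem integral_increment_mul (hB : IsFractionalBrownianMotion P ℱ H B) {s t u v : ℝ}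
    (hs : s ∈ Icc (0 : ℝ) 1) (ht : t ∈ Icc (0 : ℝ) 1) (hu : u ∈ Icc (0 : ℝ) 1)
    (hv : v ∈ Icc (0 : ℝ) 1) :
    ∫ ω, (samplePath B ω t - samplePath B ω s) * (samplePath B ω v - samplePath B ω u) ∂P =
      (|t - u| ^ (2 * H) + |v - s| ^ (2 * H) - |t - v| ^ (2 * H) - |u - s| ^ (2 * H)) / 2 := by
  have e : ∀ ω, (samplePath B ω t - samplePath B ω s) * (samplePath B ω v - samplePath B ω u) =
      (samplePath B ω v * samplePath B ω t - samplePath B ω u * samplePath B ω t) -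
      (samplePath B ω s * samplePath B ω v - samplePath B ω s * samplePath B ω u) :=
    fun ω => by ring
  simp_rw [e]
  have i := hB.integrable_mul
  have j : ∀ a b c d, Integrable (fun ω => samplePath B ω a * samplePath B ω b -
    samplePath B ω c * samplePath B ω d) P := fun a b c d => (i a b).sub (i c d)
  rw [integral_sub (j _ _ _ _) (j _ _ _ _), integral_sub (i _ _) (i _ _),
    integral_sub (i _ _) (i _ _), hB.integral_mul ht hv, hB.integral_mul ht hu,
    hB.integral_mul hv hs, hB.integral_mul hu hs]
  ring

theorem integral_increment_sq (hB : IsFractionalBrownianMotion P ℱ H B) (hH : 0 < H) {s t : ℝ}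
    (hs : s ∈ Icc (0 : ℝ) 1) (ht : t ∈ Icc (0 : ℝ) 1) :
    ∫ ω, (samplePath B ω t - samplePath B ω s) ^ 2 ∂P = |t - s| ^ (2 * H) := by
  simp_rw [sq]
  rw [hB.integral_increment_mul hs ht hs ht]
  simp [Real.zero_rpow (by linarith : 2 * H ≠ 0)]

end IsFractionalBrownianMotion

/-! ### Centred Gaussian variables: cosine moments and tails. -/

/-- A centred Gaussian variable has the law of a multiple of a standard one. -/
theorem HasGaussianLaw.map_eq_of_centered {Ω : Type*} {m : MeasurableSpace Ω} {P : Measure Ω}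
    {X : Ω → ℝ} (hX : HasGaussianLaw X P) (h0 : ∫ ω, X ω ∂P = 0) :
    P.map X = gaussianReal 0 (∫ ω, X ω ^ 2 ∂P).toNNReal := by
  rw [hX.map_eq_gaussianReal, h0, variance_of_integral_eq_zero hX.aemeasurable h0]

/-- The real part of the characteristic function at `1`. -/
theorem HasGaussianLaw.integral_cos {Ω : Type*} {m : MeasurableSpace Ω} {P : Measure Ω}
    {X : Ω → ℝ} (hX : HasGaussianLaw X P) (h0 : ∫ ω, X ω ∂P = 0) :
    ∫ ω, Real.cos (X ω) ∂P = Real.exp (-(∫ ω, X ω ^ 2 ∂P) / 2) := by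
  have := hX.isProbabilityMeasure
  have h1 : charFun (P.map X) 1 = Complex.exp (-(∫ ω, X ω ^ 2 ∂P : ℝ) / 2) := by
    rw [HasGaussianLaw.map_eq_of_centered hX h0, charFun_gaussianReal]
    have : 0 ≤ ∫ ω, X ω ^ 2 ∂P := integral_nonneg fun ω => sq_nonneg _
    congr 1
    simp [Real.coe_toNNReal _ this]
    ring
  rw [charFun_apply_real, integral_map hX.aemeasurable (by fun_prop)] at h1
  have h2 := congrArg Complex.re h1
  have hint : Integrable (fun ω => Complex.exp ((1 : ℝ) * (X ω : ℂ) * Complex.I)) P := by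
    have hm := hX.aemeasurable
    refine (integrable_const (1 : ℝ)).mono' (by fun_prop) (ae_of_all _ fun ω => ?_)
    rw [← Complex.ofReal_mul, Complex.norm_exp_ofReal_mul_I]
  have h3 := integral_re hint
  simp only [RCLike.re_to_complex] at h3
  rw [← h3] at h2
  have e : ∀ ω, (Complex.exp ((1 : ℝ) * (X ω : ℂ) * Complex.I)).re = Real.cos (X ω) := by
    intro ω
    rw [← Complex.ofReal_mul, Complex.exp_ofReal_mul_I_re, one_mul]
  simp_rw [e] at h2
  rw [h2]
  norm_cast

/-- Markov's inequality for the `n`-th absolute moment, after scaling to a standard Gaussian. The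
power `n` is free so that any polynomial decay can be extracted. -/
theorem HasGaussianLaw.measureReal_le_abs_le {Ω : Type*} {m : MeasurableSpace Ω} {P : Measure Ω}
    {X : Ω → ℝ} (hX : HasGaussianLaw X P) (h0 : ∫ ω, X ω ∂P = 0) {σ a : ℝ} (hσ : 0 ≤ σ)
    (ha : 0 < a) (hv : ∫ ω, X ω ^ 2 ∂P = σ ^ 2) (n : ℕ) :
    P.real {ω | a ≤ |X ω|} ≤ (∫ x, |x| ^ n ∂(gaussianReal 0 1)) * (σ / a) ^ n := by
  have h1 : P.map X = (gaussianReal 0 1).map (σ * ·) := by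
    rw [HasGaussianLaw.map_eq_of_centered hX h0, gaussianReal_map_const_mul, hv]
    congr 1
    · simp
    · ext; simp [sq_nonneg]
  have hs : MeasurableSet {x : ℝ | a ≤ |x|} := measurableSet_le (by fun_prop) (by fun_prop)
  have h2 : P.real {ω | a ≤ |X ω|} = (gaussianReal 0 1).real {x | a ≤ |σ * x|} := by
    have := congrArg (fun μ : Measure ℝ => μ.real {x | a ≤ |x|}) h1
    rwa [map_measureReal_apply_of_aemeasurable hX.aemeasurable hs,
      map_measureReal_apply (by fun_prop) hs] at this
  have hint : Integrable (fun x : ℝ => |σ * x| ^ n) (gaussianReal 0 1) := by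
    have h := (memLp_id_gaussianReal (μ := 0) (v := 1) (n : NNReal)).integrable_norm_pow'
    simp only [id, Real.norm_eq_abs] at h
    simpa [abs_mul, mul_pow] using h.const_mul (|σ| ^ n)
  have h3 := mul_meas_ge_le_integral_of_nonneg (ae_of_all _ fun x => by positivity) hint (a ^ n)
  have h4 : {x : ℝ | a ≤ |σ * x|} ⊆ {x | a ^ n ≤ |σ * x| ^ n} := fun x hx => by
    exact pow_le_pow_left₀ ha.le hx n
  rw [h2]
  have h5 := h3.trans' (mul_le_mul_of_nonneg_left (measureReal_mono h4) (by positivity))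
  simp_rw [abs_mul, abs_of_nonneg hσ, mul_pow, integral_const_mul] at h5
  simp_rw [abs_mul, abs_of_nonneg hσ]
  rw [div_pow, mul_div_assoc', le_div_iff₀ (by positivity)]
  linarith

/-! ### Path regularity. -/

namespace IsFractionalBrownianMotion

variable {Ω : Type*} {m : MeasurableSpace Ω} {P : Measure Ω}
  {ℱ : Filtration (Icc (0 : ℝ) 1) m} {H : ℝ} {B : Icc (0 : ℝ) 1 → Ω → ℝ}

/-- The paths of a fractional Brownian motion are Hölder continuous of every order below `H`. -/
theorem ae_holder [IsProbabilityMeasure P] (hB : IsFractionalBrownianMotion P ℱ H B) {lam : ℝ}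
    (hl : 0 < lam) (hlH : lam < H) :
    ∀ᵐ ω ∂P, ∃ C : ℝ, 0 ≤ C ∧ ∀ x y : ℝ,
      |samplePath B ω x - samplePath B ω y| ≤ C * |x - y| ^ lam := by
  -- With `(H - lam) n ≥ 2` a single bad increment at level `k` has probability at most `M 4^(-k)`;
  -- the union over `2^k` increments is then summable in `k`.
  obtain ⟨n, hn⟩ := exists_nat_ge (2 / (H - lam))
  have hn2 : 2 ≤ (H - lam) * n := by
    rw [div_le_iff₀ (by linarith)] at hn; linarith
  set q : ℝ := (1 / 2 : ℝ) ^ lam with hq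
  have hq0 : 0 < q := by positivity
  set M : ℝ := ∫ x, |x| ^ n ∂(gaussianReal 0 1) with hM
  have hM0 : 0 ≤ M := integral_nonneg fun x => by positivity
  let A : ℕ → ℕ → Set Ω := fun k j =>
    {ω | q ^ k ≤ |samplePath B ω ((j + 1) / 2 ^ k) - samplePath B ω (j / 2 ^ k)|}
  have hA : ∀ k j, j < 2 ^ k → P (A k j) ≤ ENNReal.ofReal (M * (1 / 4) ^ k) := by
    intro k j hj
    have hp : (0 : ℝ) < 2 ^ k := by positivity
    have hj' : (j : ℝ) + 1 ≤ 2 ^ k := by exact_mod_cast hj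
    have m1 : ((j : ℝ) + 1) / 2 ^ k ∈ Icc (0 : ℝ) 1 :=
      ⟨by positivity, by rw [div_le_one hp]; exact hj'⟩
    have m2 : (j : ℝ) / 2 ^ k ∈ Icc (0 : ℝ) 1 :=
      ⟨by positivity, by rw [div_le_one hp]; linarith⟩
    have hd : ((j : ℝ) + 1) / 2 ^ k - j / 2 ^ k = (1 / 2) ^ k := by
      rw [one_div, inv_pow]; field_simp; ring
    have hv : ∫ ω, (samplePath B ω ((j + 1) / 2 ^ k) - samplePath B ω (j / 2 ^ k)) ^ 2 ∂P =
        (((1 / 2 : ℝ) ^ H) ^ k) ^ 2 := by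
      rw [hB.integral_increment_sq (by linarith) m2 m1, hd, abs_of_pos (by positivity),
        ← pow_mul, ← Real.rpow_natCast_mul (by norm_num), ← Real.rpow_mul_natCast (by norm_num)]
      congr 1
      push_cast
      ring
    have := HasGaussianLaw.measureReal_le_abs_le (hB.hasGaussianLaw_increment (j / 2 ^ k)
      ((j + 1) / 2 ^ k)) (hB.integral_increment _ _) (σ := ((1 / 2 : ℝ) ^ H) ^ k) (a := q ^ k)
      (by positivity) (by positivity) hv n
    rw [← ofReal_measureReal]
    refine ENNReal.ofReal_le_ofReal (this.trans ?_)
    gcongr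
    rw [← div_pow, ← pow_mul, mul_comm, pow_mul]
    gcongr
    rw [hq, ← Real.rpow_sub (by norm_num), ← Real.rpow_natCast, ← Real.rpow_mul (by norm_num)]
    calc (1 / 2 : ℝ) ^ ((H - lam) * n) ≤ (1 / 2 : ℝ) ^ (2 : ℝ) :=
          Real.rpow_le_rpow_of_exponent_ge (by norm_num) (by norm_num) hn2
      _ = 1 / 4 := by norm_num
  have hU : ∀ k, P (⋃ j ∈ Finset.range (2 ^ k), A k j) ≤ ENNReal.ofReal (M * (1 / 2) ^ k) := by
    intro k
    refine (measure_biUnion_finset_le _ _).trans ?_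
    refine (Finset.sum_le_sum fun j hj => hA k j (Finset.mem_range.1 hj)).trans ?_
    rw [Finset.sum_const, Finset.card_range, nsmul_eq_mul, ← ENNReal.ofReal_natCast,
      ← ENNReal.ofReal_mul (by positivity)]
    refine ENNReal.ofReal_le_ofReal (le_of_eq ?_)
    have : (1 / 2 : ℝ) ^ k = 2 ^ k * (1 / 4) ^ k := by rw [← mul_pow]; norm_num
    rw [this]
    push_cast
    ring
  have hsum : ∑' k, P (⋃ j ∈ Finset.range (2 ^ k), A k j) ≠ ∞ := by
    refine ne_top_of_le_ne_top ?_ (ENNReal.tsum_le_tsum hU)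
    rw [← ENNReal.ofReal_tsum_of_nonneg (fun k => by positivity)
      ((summable_geometric_of_lt_one (by norm_num) (by norm_num)).mul_left _)]
    exact ENNReal.ofReal_ne_top
  filter_upwards [ae_eventually_notMem hsum] with ω hω
  obtain ⟨C, hC0, hC⟩ := holder_of_eventually_dyadic (hB.continuous_samplePath ω) hl (by
    filter_upwards [hω] with k hk j hj
    simp only [mem_iUnion, Finset.mem_range, not_exists] at hk
    exact (not_le.1 (hk j hj)).le)
  refine ⟨C, hC0, fun x y => ?_⟩
  -- The extended path factors through the projection onto `[0,1]`, which is 1-Lipschitz, so the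
  -- Hölder bound extends to the whole line.
  have e : ∀ x, samplePath B ω x = samplePath B ω (projIcc (0 : ℝ) 1 zero_le_one x) := fun x => by
    simp [samplePath, IccExtend]
  rw [e x, e y]
  refine (hC _ (projIcc _ _ _ x).2 _ (projIcc _ _ _ y).2).trans ?_
  exact mul_le_mul_of_nonneg_left
    (Real.rpow_le_rpow (abs_nonneg _) (abs_projIcc_sub_projIcc _) hl.le) hC0

end IsFractionalBrownianMotion

/-! ### Concentration of the truncated increments over a grid. -/

/-- Midpoint convexity. With `p = 2 * H` it says that two increments of equal length are
nonnegatively correlated, which is where `H ≥ 1/2` enters. -/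
theorem two_mul_abs_rpow_le {p : ℝ} (hp : 1 ≤ p) (d δ : ℝ) :
    2 * |d| ^ p ≤ |d + δ| ^ p + |d - δ| ^ p := by
  have h1 : |d| ≤ (1 / 2) * |d + δ| + (1 / 2) * |d - δ| := by
    have := abs_add_le (d + δ) (d - δ)
    rw [show d + δ + (d - δ) = 2 * d by ring, abs_mul, abs_two] at this
    linarith
  have h2 := (convexOn_rpow hp).2 (mem_Ici.2 (abs_nonneg (d + δ))) (mem_Ici.2 (abs_nonneg (d - δ)))
    (by norm_num : (0 : ℝ) ≤ 1 / 2) (by norm_num : (0 : ℝ) ≤ 1 / 2) (by norm_num)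
  simp only [smul_eq_mul] at h2
  have h3 := Real.rpow_le_rpow (abs_nonneg d) h1 (by linarith : 0 ≤ p)
  linarith

theorem cosh_sub_one_le {r : ℝ} (h0 : 0 ≤ r) (h1 : r ≤ 1) : Real.cosh r - 1 ≤ r := by
  have h2 := Real.cosh_le_exp_half_sq r
  have h4 : r ^ 2 ≤ r := by nlinarith
  have h3 := Real.abs_exp_sub_one_le (x := r ^ 2 / 2) (by rw [abs_of_nonneg (by positivity)]; linarith)
  rw [abs_of_nonneg (by positivity : 0 ≤ r ^ 2 / 2)] at h3
  linarith [le_abs_self (Real.exp (r ^ 2 / 2) - 1)]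

/-- For standard Gaussian `X`, `Y` with nonnegative covariance the covariance of `cos X` and `cos Y`
is at most the covariance of `X` and `Y`. -/
theorem integral_cos_sub_mul_cos_sub_le {Ω : Type*} {m : MeasurableSpace Ω} {P : Measure Ω}
    {X Y : Ω → ℝ} (hX : HasGaussianLaw X P) (hY : HasGaussianLaw Y P)
    (hadd : HasGaussianLaw (fun ω => X ω + Y ω) P) (hsub : HasGaussianLaw (fun ω => X ω - Y ω) P)
    (hX0 : ∫ ω, X ω ∂P = 0) (hY0 : ∫ ω, Y ω ∂P = 0) (hX1 : ∫ ω, X ω ^ 2 ∂P = 1)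
    (hY1 : ∫ ω, Y ω ^ 2 ∂P = 1) (hXY : 0 ≤ ∫ ω, X ω * Y ω ∂P) :
    ∫ ω, (Real.exp (-1 / 2) - Real.cos (X ω)) * (Real.exp (-1 / 2) - Real.cos (Y ω)) ∂P ≤
      ∫ ω, X ω * Y ω ∂P := by
  have := hX.isProbabilityMeasure
  set r := ∫ ω, X ω * Y ω ∂P with hr
  have iX2 : Integrable (fun ω => X ω ^ 2) P := hX.memLp_two.integrable_sq
  have iY2 : Integrable (fun ω => Y ω ^ 2) P := hY.memLp_two.integrable_sq
  have iXY : Integrable (fun ω => X ω * Y ω) P := hX.memLp_two.integrable_mul hY.memLp_two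
  have iXY2 : Integrable (fun ω => X ω ^ 2 + Y ω ^ 2) P := iX2.add iY2
  have va : ∫ ω, (X ω + Y ω) ^ 2 ∂P = 2 + 2 * r := by
    have e : ∀ ω, (X ω + Y ω) ^ 2 = (X ω ^ 2 + Y ω ^ 2) + 2 * (X ω * Y ω) := fun ω => by ring
    simp_rw [e]
    rw [integral_add iXY2 (iXY.const_mul 2),
      integral_add iX2 iY2, integral_const_mul, hX1, hY1]
    ring
  have vs : ∫ ω, (X ω - Y ω) ^ 2 ∂P = 2 - 2 * r := by
    have e : ∀ ω, (X ω - Y ω) ^ 2 = (X ω ^ 2 + Y ω ^ 2) - 2 * (X ω * Y ω) := fun ω => by ring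
    simp_rw [e]
    rw [integral_sub iXY2 (iXY.const_mul 2),
      integral_add iX2 iY2, integral_const_mul, hX1, hY1]
    ring
  have r1 : r ≤ 1 := by
    have : 0 ≤ ∫ ω, (X ω - Y ω) ^ 2 ∂P := integral_nonneg fun ω => sq_nonneg _
    linarith
  have ca := HasGaussianLaw.integral_cos hadd
    (by rw [integral_add hX.integrable hY.integrable, hX0, hY0, add_zero])
  have cs := HasGaussianLaw.integral_cos hsub
    (by rw [integral_sub hX.integrable hY.integrable, hX0, hY0, sub_zero])
  have cX := HasGaussianLaw.integral_cos hX hX0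
  have cY := HasGaussianLaw.integral_cos hY hY0
  rw [va] at ca
  rw [vs] at cs
  rw [hX1] at cX
  rw [hY1] at cY
  have ic : ∀ {Z : Ω → ℝ}, HasGaussianLaw Z P → Integrable (fun ω => Real.cos (Z ω)) P := by
    intro Z hZ
    have := hZ.aemeasurable
    exact (integrable_const (1 : ℝ)).mono' (by fun_prop)
      (ae_of_all _ fun ω => Real.abs_cos_le_one _)
  -- `e` is the mean of the cosine of a standard Gaussian. As `X ± Y` has variance `2 ± 2r`, the
  -- covariance of the cosines is `exp (-1) * (cosh r - 1)`.
  set e := Real.exp (-1 / 2) with he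
  have e2 : e ^ 2 = Real.exp (-1) := by rw [he, ← Real.exp_nat_mul]; norm_num
  have ex : ∀ ω, (e - Real.cos (X ω)) * (e - Real.cos (Y ω)) =
      ((e ^ 2 - e * Real.cos (X ω)) - e * Real.cos (Y ω)) +
        ((1 / 2) * Real.cos (X ω + Y ω) + (1 / 2) * Real.cos (X ω - Y ω)) := by
    intro ω
    rw [Real.cos_add, Real.cos_sub]
    ring
  simp_rw [ex]
  have i1 : Integrable (fun ω => e ^ 2 - e * Real.cos (X ω)) P :=
    (integrable_const _).sub ((ic hX).const_mul e)
  have i2 : Integrable (fun ω => e ^ 2 - e * Real.cos (X ω) - e * Real.cos (Y ω)) P :=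
    i1.sub ((ic hY).const_mul e)
  have i3 : Integrable (fun ω => (1 / 2) * Real.cos (X ω + Y ω)) P := (ic hadd).const_mul _
  have i4 : Integrable (fun ω => (1 / 2) * Real.cos (X ω - Y ω)) P := (ic hsub).const_mul _
  have i5 : Integrable (fun ω => (1 / 2) * Real.cos (X ω + Y ω) +
    (1 / 2) * Real.cos (X ω - Y ω)) P := i3.add i4
  rw [integral_add i2 i5, integral_add i3 i4, integral_sub i1 ((ic hY).const_mul e),
    integral_sub (integrable_const _) ((ic hX).const_mul e), integral_const_mul, integral_const_mul,
    integral_const_mul, integral_const_mul, cX, cY, ca, cs]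
  simp only [integral_const, probReal_univ, one_smul]
  have hc : Real.exp (-(2 + 2 * r) / 2) + Real.exp (-(2 - 2 * r) / 2) =
      Real.exp (-1) * (2 * Real.cosh r) := by
    rw [Real.cosh_eq, show -(2 + 2 * r) / 2 = -1 + -r by ring,
      show -(2 - 2 * r) / 2 = -1 + r by ring, Real.exp_add, Real.exp_add]
    ring
  have h5 := cosh_sub_one_le hXY r1
  have h6 : Real.exp (-1) ≤ 1 := Real.exp_le_one_iff.2 (by norm_num)
  have h7 : Real.exp (-1) * (Real.cosh r - 1) ≤ 1 * r :=
    mul_le_mul h6 h5 (by linarith [Real.one_le_cosh r]) (by norm_num)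
  nlinarith

namespace IsFractionalBrownianMotion

variable {Ω : Type*} {m : MeasurableSpace Ω} {P : Measure Ω}
  {ℱ : Filtration (Icc (0 : ℝ) 1) m} {H : ℝ} {B : Icc (0 : ℝ) 1 → Ω → ℝ}

/-- Supplies the Gaussian laws of the sum and the difference of two normalised increments. -/
theorem hasGaussianLaw_lincomb (hB : IsFractionalBrownianMotion P ℱ H B) (s t u v c d : ℝ) :
    HasGaussianLaw (fun ω => c * (samplePath B ω t - samplePath B ω s) +
      d * (samplePath B ω v - samplePath B ω u)) P := by
  let p : Fin 4 → ℝ := ![s, t, u, v]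
  let w : Fin 4 → ℝ := ![-c, c, -d, d]
  have h1 : IsGaussianProcess (fun (i : Fin 4) ω => samplePath B ω (p i)) P :=
    hB.isGaussianProcess_samplePath.comp_right p
  have h2 := (h1.smul w).hasGaussianLaw_fun_sum (I := Finset.univ)
  refine h2.congr (ae_of_all _ fun ω => ?_)
  simp [Fin.sum_univ_four, p, w]
  ring

/-- Over a uniform grid of an interval the truncated increments `1 - cos` accumulate linearly in the
number of grid cells, except with small probability. -/
theorem measureReal_sum_one_sub_cos_lt [IsProbabilityMeasure P]
    (hB : IsFractionalBrownianMotion P ℱ H B)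
    (hH : 1 / 2 ≤ H) {a δ : ℝ} {N : ℕ} (ha : 0 ≤ a) (hδ : 0 < δ) (hN : 0 < N)
    (h1 : a + N * δ ≤ 1) :
    P.real {ω | ∑ j ∈ Finset.range N, (1 - Real.cos ((samplePath B ω (a + (j + 1 : ℕ) * δ) -
      samplePath B ω (a + j * δ)) / δ ^ H)) < N / 6} ≤ 36 * (N : ℝ) ^ (2 * H - 2) := by
  have hN' : (0 : ℝ) < N := by exact_mod_cast hN
  set σ := δ ^ H with hσ
  have hσ0 : 0 < σ := by positivity
  have hσ2 : σ ^ 2 = δ ^ (2 * H) := by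
    rw [hσ, ← Real.rpow_mul_natCast hδ.le]; congr 1; push_cast; ring
  let s : ℕ → ℝ := fun j => a + j * δ
  have hs : ∀ j ≤ N, s j ∈ Icc (0 : ℝ) 1 := by
    intro j hj
    refine ⟨by positivity, le_trans ?_ h1⟩
    have : (j : ℝ) ≤ N := by exact_mod_cast hj
    simp only [s]; gcongr
  let Z : ℕ → Ω → ℝ := fun j ω => (samplePath B ω (s (j + 1)) - samplePath B ω (s j)) / σ
  have gl : ∀ i j c d, HasGaussianLaw (fun ω => c * Z i ω + d * Z j ω) P := by
    intro i j c d
    refine (hB.hasGaussianLaw_lincomb (s i) (s (i + 1)) (s j) (s (j + 1)) (c / σ) (d / σ)).congr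
      (ae_of_all _ fun ω => ?_)
    simp only [Z]; ring
  have gZ : ∀ i, HasGaussianLaw (Z i) P := fun i => by simpa using gl i i 1 0
  have Z0 : ∀ i, ∫ ω, Z i ω ∂P = 0 := fun i => by
    simp only [Z]
    rw [integral_div, hB.integral_increment, zero_div]
  have Z1 : ∀ i < N, ∫ ω, Z i ω ^ 2 ∂P = 1 := fun i hi => by
    simp only [Z, div_pow]
    rw [integral_div, hB.integral_increment_sq (by linarith) (hs i (by omega)) (hs _ (by omega)),
      hσ2]
    have : s (i + 1) - s i = δ := by simp only [s]; push_cast; ring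
    rw [this, abs_of_pos hδ, div_self (by positivity)]
  have Zc : ∀ i < N, ∀ j < N, 0 ≤ ∫ ω, Z i ω * Z j ω ∂P := by
    intro i hi j hj
    have e : ∀ ω, Z i ω * Z j ω = ((samplePath B ω (s (i + 1)) - samplePath B ω (s i)) *
      (samplePath B ω (s (j + 1)) - samplePath B ω (s j))) / σ ^ 2 := fun ω => by
      simp only [Z]; field_simp
    simp_rw [e]
    rw [integral_div, hB.integral_increment_mul (hs i (by omega)) (hs _ (by omega))
      (hs j (by omega)) (hs _ (by omega))]
    refine div_nonneg ?_ (by positivity)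
    have := two_mul_abs_rpow_le (p := 2 * H) (by linarith) (s i - s j) δ
    rw [show s (i + 1) - s j = s i - s j + δ by simp only [s]; push_cast; ring,
      show s (j + 1) - s i = -(s i - s j - δ) by simp only [s]; push_cast; ring,
      show s (i + 1) - s (j + 1) = s i - s j by simp only [s]; push_cast; ring,
      show s j - s i = -(s i - s j) by ring, abs_neg, abs_neg]
    linarith
  set e := Real.exp (-1 / 2) with he
  -- Each term `1 - cos` then has mean at least `1/3`, so a sum below `N / 6` deviates from its mean
  -- by at least `N / 6`.
  have he' : e ≤ 2 / 3 := by
    have h := Real.add_one_le_exp (1 / 2 : ℝ)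
    rw [he, show (-1 / 2 : ℝ) = -(1 / 2) by ring, Real.exp_neg]
    rw [show (2 / 3 : ℝ) = (3 / 2)⁻¹ by norm_num]
    exact inv_anti₀ (by norm_num) (by linarith)
  let D : Ω → ℝ := fun ω => ∑ j ∈ Finset.range N, (e - Real.cos (Z j ω))
  have hD : ∫ ω, D ω ^ 2 ∂P ≤ (N : ℝ) ^ (2 * H) := by
    have i1 : ∀ i j, Integrable (fun ω => (e - Real.cos (Z i ω)) * (e - Real.cos (Z j ω))) P := by
      intro i j
      have h1 := (gZ i).aemeasurable
      have h2 := (gZ j).aemeasurable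
      have b : ∀ x, |e - Real.cos x| ≤ 2 := fun x => by
        have := Real.exp_pos (-1 / 2)
        rw [abs_le]; constructor <;> linarith [Real.cos_le_one x, Real.neg_one_le_cos x]
      refine (integrable_const (4 : ℝ)).mono' (by fun_prop) (ae_of_all _ fun ω => ?_)
      rw [Real.norm_eq_abs, abs_mul]
      nlinarith [b (Z i ω), b (Z j ω), abs_nonneg (e - Real.cos (Z i ω)),
        abs_nonneg (e - Real.cos (Z j ω))]
    have i2 : ∀ i j, Integrable (fun ω => Z i ω * Z j ω) P := fun i j =>
      (gZ i).memLp_two.integrable_mul (gZ j).memLp_two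
    have e1 : ∀ (f : ℕ → ℝ), (∑ j ∈ Finset.range N, f j) ^ 2 =
        ∑ i ∈ Finset.range N, ∑ j ∈ Finset.range N, f i * f j := fun f => by
      rw [sq, Finset.sum_mul_sum]
    -- The double sum is the second moment of the sum of the normalised increments, which telescopes
    -- to one increment of length `N * δ`.
    have tot : ∑ i ∈ Finset.range N, ∑ j ∈ Finset.range N, ∫ ω, Z i ω * Z j ω ∂P =
        (N : ℝ) ^ (2 * H) := by
      have : ∫ ω, (∑ j ∈ Finset.range N, Z j ω) ^ 2 ∂P =
          ∑ i ∈ Finset.range N, ∑ j ∈ Finset.range N, ∫ ω, Z i ω * Z j ω ∂P := by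
        simp_rw [e1]
        rw [integral_finsetSum _ fun i _ => integrable_finsetSum _ fun j _ => i2 i j]
        exact Finset.sum_congr rfl fun i _ => integral_finsetSum _ fun j _ => i2 i j
      rw [← this]
      have tel : ∀ ω, ∑ j ∈ Finset.range N, Z j ω =
          (samplePath B ω (s N) - samplePath B ω (s 0)) / σ := fun ω => by
        simp only [Z]
        rw [← Finset.sum_div, Finset.sum_range_sub (fun j => samplePath B ω (s j))]
      simp_rw [tel, div_pow]
      rw [integral_div, hB.integral_increment_sq (by linarith) (hs 0 (by omega)) (hs N le_rfl), hσ2,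
        show s N - s 0 = N * δ by simp only [s]; push_cast; ring, abs_of_pos (by positivity),
        Real.mul_rpow hN'.le hδ.le]
      field_simp
    rw [← tot]
    simp only [D, e1]
    rw [integral_finsetSum _ fun i _ => integrable_finsetSum _ fun j _ => i1 i j]
    refine Finset.sum_le_sum fun i hi => ?_
    rw [integral_finsetSum _ fun j _ => i1 i j]
    refine Finset.sum_le_sum fun j hj => ?_
    have hi := Finset.mem_range.1 hi
    have hj := Finset.mem_range.1 hj
    exact integral_cos_sub_mul_cos_sub_le (gZ i) (gZ j) (by simpa using gl i j 1 1)
      (by simpa [sub_eq_add_neg] using gl i j 1 (-1)) (Z0 i) (Z0 j) (Z1 i hi) (Z1 j hj)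
      (Zc i hi j hj)
  have hDi : Integrable (fun ω => D ω ^ 2) P := by
    have hm : AEStronglyMeasurable D P := by
      have : ∀ i, AEMeasurable (Z i) P := fun i => (gZ i).aemeasurable
      simp only [D]; fun_prop
    refine MemLp.integrable_sq (MemLp.of_bound hm (N * 2) (ae_of_all _ fun ω => ?_))
    refine (norm_sum_le _ _).trans ?_
    refine (Finset.sum_le_card_nsmul _ _ 2 fun j _ => ?_).trans (by simp)
    have := Real.exp_pos (-1 / 2)
    rw [Real.norm_eq_abs, abs_le]
    constructor <;> linarith [Real.cos_le_one (Z j ω), Real.neg_one_le_cos (Z j ω)]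
  have hsub : {ω | ∑ j ∈ Finset.range N, (1 - Real.cos ((samplePath B ω (a + (j + 1 : ℕ) * δ) -
      samplePath B ω (a + j * δ)) / σ)) < N / 6} ⊆ {ω | ((N : ℝ) / 6) ^ 2 ≤ D ω ^ 2} := by
    intro ω hω
    have hω' : ∑ j ∈ Finset.range N, (1 - Real.cos (Z j ω)) < N / 6 := hω
    have e1 : ∑ j ∈ Finset.range N, (1 - Real.cos (Z j ω)) = N * (1 - e) + D ω := by
      simp only [D, Finset.sum_sub_distrib, Finset.sum_const, Finset.card_range, nsmul_eq_mul]
      ring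
    have : (N : ℝ) / 6 ≤ -D ω := by nlinarith
    have h := pow_le_pow_left₀ (by positivity) this 2
    simpa using h
  have hM := mul_meas_ge_le_integral_of_nonneg (ae_of_all _ fun ω => sq_nonneg (D ω)) hDi
    (((N : ℝ) / 6) ^ 2)
  have h8 := (mul_le_mul_of_nonneg_left (measureReal_mono hsub)
    (sq_nonneg ((N : ℝ) / 6))).trans (hM.trans hD)
  have h9 : (N : ℝ) ^ (2 * H - 2) = (N : ℝ) ^ (2 * H) / N ^ 2 := by
    rw [Real.rpow_sub hN']; norm_cast
  rw [h9, mul_div_assoc', le_div_iff₀ (by positivity)]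
  nlinarith

end IsFractionalBrownianMotion

/-! ### Fubini on triangles, power integrals and the beta kernel. -/

section Triangle

variable {a b : ℝ} {F : ℝ → ℝ → ℝ} {k : ℝ → ℝ}

theorem indicator_lt_left {M : Type*} [Zero M] (G : ℝ × ℝ → M) (x : ℝ) :
    (fun y => {z : ℝ × ℝ | z.1 < z.2}.indicator G (y, x)) = (Iio x).indicator fun y => G (y, x) := by
  ext y; simp [indicator_apply]

theorem indicator_lt_right {M : Type*} [Zero M] (G : ℝ × ℝ → M) (y : ℝ) :
    (fun x => {z : ℝ × ℝ | z.1 < z.2}.indicator G (y, x)) = (Ioi y).indicator fun x => G (y, x) := by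
  ext x; simp [indicator_apply]

theorem restrict_Ioo_Iio {x : ℝ} (hx : x ∈ Ioo a b) :
    (volume.restrict (Ioo a b)).restrict (Iio x) = volume.restrict (Ioo a x) := by
  rw [Measure.restrict_restrict measurableSet_Iio, inter_comm, Ioo_inter_Iio, min_eq_right hx.2.le]

theorem restrict_Ioo_Ioi {x : ℝ} (hx : x ∈ Ioo a b) :
    (volume.restrict (Ioo a b)).restrict (Ioi x) = volume.restrict (Ioo x b) := by
  rw [Measure.restrict_restrict measurableSet_Ioi, inter_comm, Ioo_inter_Ioi, max_eq_right hx.1.le]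

theorem integrable_indicator_lt (hF : Measurable (Function.uncurry F))
    (hk : IntegrableOn k (Ioo a b))
    (hb : ∀ x ∈ Ioo a b, ∫⁻ y in Ioo a x, ‖F y x‖ₑ ≤ ENNReal.ofReal (k x)) :
    Integrable ({z : ℝ × ℝ | z.1 < z.2}.indicator (Function.uncurry F))
      ((volume.restrict (Ioo a b)).prod (volume.restrict (Ioo a b))) := by
  have hT : MeasurableSet {z : ℝ × ℝ | z.1 < z.2} := measurableSet_lt measurable_fst measurable_snd
  have hm : Measurable ({z : ℝ × ℝ | z.1 < z.2}.indicator (Function.uncurry F)) := hF.indicator hT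
  refine ⟨hm.aestronglyMeasurable, ?_⟩
  rw [HasFiniteIntegral, lintegral_prod_symm' _ hm.enorm]
  refine lt_of_le_of_lt ?_ hk.lintegral_lt_top
  refine setLIntegral_mono' measurableSet_Ioo fun x hx => ?_
  refine le_trans (le_of_eq ?_) (hb x hx)
  simp_rw [enorm_indicator_eq_indicator_enorm]
  rw [indicator_lt_left, lintegral_indicator measurableSet_Iio, restrict_Ioo_Iio hx]
  rfl

/-- Fubini's theorem on a triangle. -/
theorem integral_triangle_swap (hF : Measurable (Function.uncurry F))
    (hk : IntegrableOn k (Ioo a b))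
    (hb : ∀ x ∈ Ioo a b, ∫⁻ y in Ioo a x, ‖F y x‖ₑ ≤ ENNReal.ofReal (k x)) :
    ∫ x in Ioo a b, ∫ y in Ioo a x, F y x = ∫ y in Ioo a b, ∫ x in Ioo y b, F y x := by
  have hi := integrable_indicator_lt hF hk hb
  have h := integral_integral_swap (f := fun y x =>
    {z : ℝ × ℝ | z.1 < z.2}.indicator (Function.uncurry F) (y, x)) hi
  refine Eq.trans ?_ (h.symm.trans ?_)
  · refine setIntegral_congr_fun measurableSet_Ioo fun x hx => ?_
    rw [indicator_lt_left, integral_indicator measurableSet_Iio, restrict_Ioo_Iio hx]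
    rfl
  · refine setIntegral_congr_fun measurableSet_Ioo fun x hx => ?_
    rw [indicator_lt_right, integral_indicator measurableSet_Ioi, restrict_Ioo_Ioi hx]
    rfl

theorem measurable_setIntegral_Ioo_left (hF : Measurable (Function.uncurry F)) (b : ℝ) :
    Measurable fun x => ∫ u in Ioo x b, F x u := by
  have hT : MeasurableSet {z : ℝ × ℝ | z.1 < z.2 ∧ z.2 < b} :=
    (measurableSet_lt measurable_fst measurable_snd).inter
      (measurableSet_lt measurable_snd measurable_const)
  have h := (hF.indicator hT).stronglyMeasurable.integral_prod_right' (ν := volume)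
  convert! h.measurable using 2 with x
  rw [← integral_indicator measurableSet_Ioo]
  rfl

theorem measurable_setIntegral_Ioo_right (hF : Measurable (Function.uncurry F)) (a : ℝ) :
    Measurable fun x => ∫ u in Ioo a x, F x u := by
  have hT : MeasurableSet {z : ℝ × ℝ | a < z.2 ∧ z.2 < z.1} :=
    (measurableSet_lt measurable_const measurable_snd).inter
      (measurableSet_lt measurable_snd measurable_fst)
  have h := (hF.indicator hT).stronglyMeasurable.integral_prod_right' (ν := volume)
  convert! h.measurable using 2 with x
  rw [← integral_indicator measurableSet_Ioo]
  rfl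

end Triangle

theorem setLIntegral_enorm_le_ofReal {f h : ℝ → ℝ} {s : Set ℝ} (hs : MeasurableSet s)
    (hi : IntegrableOn h s) (hle : ∀ x ∈ s, |f x| ≤ h x) :
    ∫⁻ x in s, ‖f x‖ₑ ≤ ENNReal.ofReal (∫ x in s, h x) := by
  rw [ofReal_integral_eq_lintegral_ofReal hi
    ((ae_restrict_iff' hs).2 (ae_of_all _ fun x hx => (abs_nonneg _).trans (hle x hx)))]
  refine setLIntegral_mono' hs fun x hx => ?_
  rw [← ofReal_norm, Real.norm_eq_abs]
  exact ENNReal.ofReal_le_ofReal (hle x hx)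

section Powers

variable {a b s : ℝ}

theorem integrableOn_sub_left_rpow (hs : -1 < s) :
    IntegrableOn (fun x => (x - a) ^ s) (Ioo a b) := by
  rcases le_or_gt a b with h | h
  · have h1 := (intervalIntegral.intervalIntegrable_rpow' (a := 0) (b := b - a) hs).comp_sub_right a
    rw [zero_add, sub_add_cancel] at h1
    exact ((intervalIntegrable_iff_integrableOn_Ioo_of_le h).1 h1)
  · simp [Ioo_eq_empty_of_le h.le]

theorem integrableOn_sub_right_rpow (hs : -1 < s) :
    IntegrableOn (fun x => (b - x) ^ s) (Ioo a b) := by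
  rcases le_or_gt a b with h | h
  · have h1 := (intervalIntegral.intervalIntegrable_rpow' (a := 0) (b := b - a) hs).comp_sub_left b
    rw [sub_zero, sub_sub_cancel] at h1
    exact ((intervalIntegrable_iff_integrableOn_Ioo_of_le h).1 h1.symm)
  · simp [Ioo_eq_empty_of_le h.le]

theorem setIntegral_sub_left_rpow (hs : -1 < s) (h : a ≤ b) :
    ∫ x in Ioo a b, (x - a) ^ s = (b - a) ^ (s + 1) / (s + 1) := by
  rw [← integral_Ioc_eq_integral_Ioo, ← intervalIntegral.integral_of_le h,
    intervalIntegral.integral_comp_sub_right (fun x => x ^ s), sub_self,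
    integral_rpow (Or.inl hs), Real.zero_rpow (by linarith), sub_zero]

theorem setIntegral_sub_right_rpow (hs : -1 < s) (h : a ≤ b) :
    ∫ x in Ioo a b, (b - x) ^ s = (b - a) ^ (s + 1) / (s + 1) := by
  rw [← integral_Ioc_eq_integral_Ioo, ← intervalIntegral.integral_of_le h,
    intervalIntegral.integral_comp_sub_left (fun x => x ^ s), sub_self,
    integral_rpow (Or.inl hs), Real.zero_rpow (by linarith), sub_zero]

theorem setIntegral_rpow_away_right {x : ℝ} (hs : s ≠ -1) (h : a ≤ b) (hx : b < x) :
    ∫ u in Ioo a b, (x - u) ^ s = ((x - a) ^ (s + 1) - (x - b) ^ (s + 1)) / (s + 1) := by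
  rw [← integral_Ioc_eq_integral_Ioo, ← intervalIntegral.integral_of_le h,
    intervalIntegral.integral_comp_sub_left (fun x => x ^ s), integral_rpow]
  refine Or.inr ⟨hs, fun h0 => ?_⟩
  rw [uIcc_of_le (by linarith)] at h0
  linarith [h0.1]

theorem setIntegral_rpow_away_left {x : ℝ} (hs : s ≠ -1) (h : a ≤ b) (hx : x < a) :
    ∫ u in Ioo a b, (u - x) ^ s = ((b - x) ^ (s + 1) - (a - x) ^ (s + 1)) / (s + 1) := by
  rw [← integral_Ioc_eq_integral_Ioo, ← intervalIntegral.integral_of_le h,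
    intervalIntegral.integral_comp_sub_right (fun x => x ^ s), integral_rpow]
  refine Or.inr ⟨hs, fun h0 => ?_⟩
  rw [uIcc_of_le (by linarith)] at h0
  linarith [h0.1]

theorem integrableOn_rpow_away_right {x : ℝ} (hx : b < x) :
    IntegrableOn (fun u => (x - u) ^ s) (Ioo a b) := by
  have hc : ContinuousOn (fun u => (x - u) ^ s) (Icc a b) := by
    refine ContinuousOn.rpow_const (by fun_prop) fun u hu => Or.inl ?_
    linarith [hu.2]
  exact hc.integrableOn_Icc.mono_set Ioo_subset_Icc_self

end Powers

/-- The real part of the complex beta integral, with `Γ(1) = 1` in the denominator. -/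
theorem intervalIntegrable_betaKernel_unit {β : ℝ} (h0 : 0 < β) (h1 : β < 1) :
    IntervalIntegrable (fun x : ℝ => x ^ (-β) * (1 - x) ^ (β - 1)) volume 0 1 ∧
    ∫ x in (0 : ℝ)..1, x ^ (-β) * (1 - x) ^ (β - 1) = Real.Gamma (1 - β) * Real.Gamma β := by
  have hc := Complex.betaIntegral_convergent (u := ((1 - β : ℝ) : ℂ)) (v := (β : ℂ))
    (by simpa using h1) (by simpa using h0)
  have e : ∀ x ∈ Ioc (0 : ℝ) 1, ((x : ℂ) ^ (((1 - β : ℝ) : ℂ) - 1) *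
      (1 - (x : ℂ)) ^ ((β : ℂ) - 1)).re = x ^ (-β) * (1 - x) ^ (β - 1) := by
    intro x hx
    norm_cast
    rw [← Complex.ofReal_cpow hx.1.le, ← Complex.ofReal_cpow (by linarith [hx.2]),
      Complex.re_mul_ofReal, Complex.ofReal_re]
    congr 2
    ring
  rw [intervalIntegrable_iff_integrableOn_Ioc_of_le zero_le_one] at hc ⊢
  refine ⟨(integrableOn_congr_fun e measurableSet_Ioc).1 hc.re, ?_⟩
  have h2 := beta_eq_betaIntegralReal (1 - β) β (by linarith) h0
  rw [beta, sub_add_cancel, Real.Gamma_one, div_one] at h2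
  rw [h2, Complex.betaIntegral, intervalIntegral.integral_of_le zero_le_one,
    intervalIntegral.integral_of_le zero_le_one, ← RCLike.re_to_complex, ← integral_re hc]
  exact (setIntegral_congr_fun measurableSet_Ioc e).symm

/-- Euler's beta integral over `(u, y)` with exponents adding up to `-1`. -/
theorem betaKernel {β u y : ℝ} (h0 : 0 < β) (h1 : β < 1) (h : u < y) :
    IntegrableOn (fun x => (x - u) ^ (-β) * (y - x) ^ (β - 1)) (Ioo u y) ∧
    ∫ x in Ioo u y, (x - u) ^ (-β) * (y - x) ^ (β - 1) = Real.Gamma (1 - β) * Real.Gamma β := by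
  obtain ⟨hi, hv⟩ := intervalIntegrable_betaKernel_unit h0 h1
  have hd : 0 < y - u := by linarith
  set f : ℝ → ℝ := fun x => x ^ (-β) * (1 - x) ^ (β - 1) with hf
  have e : ∀ x ∈ Ioo u y, (y - u)⁻¹ * f ((y - u)⁻¹ * (x - u)) =
      (x - u) ^ (-β) * (y - x) ^ (β - 1) := by
    intro x hx
    have h2 : 1 - (y - u)⁻¹ * (x - u) = (y - u)⁻¹ * (y - x) := by field_simp; ring
    simp only [hf]
    rw [h2, Real.mul_rpow (by positivity) (by linarith [hx.1]),
      Real.mul_rpow (by positivity) (by linarith [hx.2])]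
    have h3 : (y - u)⁻¹ * ((y - u)⁻¹ ^ (-β) * (y - u)⁻¹ ^ (β - 1)) = 1 := by
      rw [← Real.rpow_add (by positivity), show -β + (β - 1) = -1 by ring, Real.rpow_neg_one,
        inv_inv, inv_mul_cancel₀ hd.ne']
    linear_combination (x - u) ^ (-β) * (y - x) ^ (β - 1) * h3
  have hi2 : IntervalIntegrable (fun x => (y - u)⁻¹ * f ((y - u)⁻¹ * (x - u))) volume u y := by
    have := ((hi.comp_mul_left (c := (y - u)⁻¹)).comp_sub_right u).const_mul (y - u)⁻¹
    simpa using this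
  rw [intervalIntegrable_iff_integrableOn_Ioo_of_le h.le] at hi2
  refine ⟨(integrableOn_congr_fun e measurableSet_Ioo).1 hi2, ?_⟩
  rw [← setIntegral_congr_fun measurableSet_Ioo e, ← integral_Ioc_eq_integral_Ioo,
    ← intervalIntegral.integral_of_le h.le, intervalIntegral.integral_const_mul,
    intervalIntegral.integral_comp_sub_right (fun x => f ((y - u)⁻¹ * x)),
    intervalIntegral.integral_comp_mul_left _ (by positivity), sub_self, mul_zero,
    inv_mul_cancel₀ hd.ne', hv, inv_inv, smul_eq_mul, inv_mul_cancel_left₀ hd.ne']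

/-! ### Weyl derivatives of Lipschitz and of Hölder functions. -/

noncomputable section

section Forward

variable {β t K : ℝ} {ψ φ : ℝ → ℝ}

theorem primitive_sub (hψ : Measurable ψ) (hK : ∀ u, |ψ u| ≤ K)
    (hφ : ∀ x ∈ Icc 0 t, φ x = ∫ u in Ioo 0 x, ψ u) {u x : ℝ} (hu : 0 ≤ u) (hux : u ≤ x)
    (hx : x ≤ t) : φ x - φ u = ∫ w in Ioo u x, ψ w := by
  have hi : ∀ a b, IntervalIntegrable ψ volume a b := fun a b =>
    (intervalIntegrable_const (c := K)).mono_fun' hψ.aestronglyMeasurable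
      (ae_of_all _ fun x => hK x)
  rw [hφ x ⟨hu.trans hux, hx⟩, hφ u ⟨hu, hux.trans hx⟩]
  simp only [← integral_Ioc_eq_integral_Ioo]
  rw [← intervalIntegral.integral_of_le hu, ← intervalIntegral.integral_of_le hux,
    ← intervalIntegral.integral_of_le (hu.trans hux),
    intervalIntegral.integral_interval_sub_left (hi _ _) (hi _ _)]

theorem abs_setIntegral_Ioo_le (hK : ∀ u, |ψ u| ≤ K) {u x : ℝ} (hux : u ≤ x) :
    |∫ w in Ioo u x, ψ w| ≤ K * (x - u) := by
  have := norm_setIntegral_le_of_norm_le_const (μ := volume) (s := Ioo u x) (f := ψ) (C := K)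
    (by simp) (fun w _ => hK w)
  simpa [Measure.real, Real.volume_Ioo, ENNReal.toReal_ofReal (sub_nonneg.2 hux)] using this

theorem abs_primitive_sub_le (hψ : Measurable ψ) (hK : ∀ u, |ψ u| ≤ K)
    (hφ : ∀ x ∈ Icc 0 t, φ x = ∫ u in Ioo 0 x, ψ u) {u x : ℝ} (hu : 0 ≤ u) (hux : u ≤ x)
    (hx : x ≤ t) : |φ x - φ u| ≤ K * (x - u) := by
  rw [primitive_sub hψ hK hφ hu hux hx]
  exact abs_setIntegral_Ioo_le hK hux

theorem abs_primitive_div_le (hψ : Measurable ψ) (hK : ∀ u, |ψ u| ≤ K)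
    (hφ : ∀ x ∈ Icc 0 t, φ x = ∫ u in Ioo 0 x, ψ u) {u x : ℝ} (hu : 0 ≤ u) (hux : u < x)
    (hx : x ≤ t) : |φ x - φ u| / (x - u) ^ (1 + β) ≤ K * (x - u) ^ (-β) := by
  have hd : 0 < x - u := by linarith
  rw [div_le_iff₀ (by positivity), mul_assoc, ← Real.rpow_add hd,
    show -β + (1 + β) = 1 by ring, Real.rpow_one]
  exact abs_primitive_sub_le hψ hK hφ hu hux.le hx

theorem integrableOn_forward (h1 : β < 1) (hψ : Measurable ψ) (hK : ∀ u, |ψ u| ≤ K)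
    (hφ : ∀ x ∈ Icc 0 t, φ x = ∫ u in Ioo 0 x, ψ u) {x : ℝ} (hx : x ∈ Ioo 0 t) :
    IntegrableOn (fun u => (φ x - φ u) / (x - u) ^ (1 + β)) (Ioo 0 x) := by
  have hm : Measurable fun x => ∫ u in Ioo 0 x, ψ u :=
    measurable_setIntegral_Ioo_right (F := fun _ u => ψ u) (hψ.comp measurable_snd) 0
  have hm2 : AEStronglyMeasurable (fun u => (φ x - φ u) / (x - u) ^ (1 + β))
      (volume.restrict (Ioo 0 x)) := by
    refine AEStronglyMeasurable.congr (f := fun u => (φ x - ∫ w in Ioo 0 u, ψ w) /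
      (x - u) ^ (1 + β)) (Measurable.aestronglyMeasurable (by fun_prop)) ?_
    filter_upwards [ae_restrict_mem measurableSet_Ioo] with u hu
    rw [hφ u ⟨hu.1.le, hu.2.le.trans hx.2.le⟩]
  refine ((integrableOn_sub_right_rpow (s := -β) (by linarith)).const_mul K).mono' hm2 ?_
  filter_upwards [ae_restrict_mem measurableSet_Ioo] with u hu
  rw [Real.norm_eq_abs, abs_div, abs_of_nonneg (Real.rpow_nonneg (by linarith [hu.2]) _)]
  exact abs_primitive_div_le hψ hK hφ hu.1.le hu.2 hx.2.le

/-- The Weyl derivative of a primitive is the fractional integral of its density. -/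
theorem forward_weyl (h0 : 0 < β) (h1 : β < 1) (hψ : Measurable ψ) (hK : ∀ u, |ψ u| ≤ K)
    (hφ : ∀ x ∈ Icc 0 t, φ x = ∫ u in Ioo 0 x, ψ u) {x : ℝ} (hx : x ∈ Ioo 0 t) :
    φ x / (x - 0) ^ β + β * ∫ u in Ioo 0 x, (φ x - φ u) / (x - u) ^ (1 + β) =
      ∫ u in Ioo 0 x, ψ u * (x - u) ^ (-β) := by
  have hK0 : 0 ≤ K := (abs_nonneg _).trans (hK 0)
  have away : ∀ w ∈ Ioo 0 x, ∫ u in Ioo 0 w, (x - u) ^ (-(1 + β)) =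
      ((x - w) ^ (-β) - x ^ (-β)) / β := by
    intro w hw
    rw [setIntegral_rpow_away_right (by linarith) hw.1.le hw.2,
      show -(1 + β) + 1 = -β by ring, sub_zero, div_neg, ← neg_div, neg_sub]
  -- The kernel `(x - u)^(-(1+β))` is not integrable up to `x`, but its integral over `(0, w)` is of
  -- order `(x - w)^(-β)`, which is integrable as `β < 1`.
  have hsw := integral_triangle_swap (a := 0) (b := x)
    (F := fun u w => ψ w * (x - u) ^ (-(1 + β))) (k := fun w => K / β * (x - w) ^ (-β))
    (by unfold Function.uncurry; fun_prop)
    ((integrableOn_sub_right_rpow (by linarith)).const_mul _) (by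
      intro w hw
      refine (setLIntegral_enorm_le_ofReal measurableSet_Ioo
        ((integrableOn_rpow_away_right (s := -(1 + β)) hw.2).const_mul K) fun u hu => ?_).trans
        (ENNReal.ofReal_le_ofReal ?_)
      · rw [abs_mul, abs_of_nonneg (Real.rpow_nonneg (by linarith [hu.2, hw.2]) _)]
        gcongr
        · exact Real.rpow_nonneg (by linarith [hu.2, hw.2]) _
        · exact hK w
      · rw [integral_const_mul, away w hw, div_mul_eq_mul_div, mul_div_assoc]
        have : 0 ≤ x ^ (-β) := Real.rpow_nonneg hx.1.le _
        gcongr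
        linarith)
  have e1 : ∫ u in Ioo 0 x, (φ x - φ u) / (x - u) ^ (1 + β) =
      ∫ u in Ioo 0 x, ∫ w in Ioo u x, ψ w * (x - u) ^ (-(1 + β)) := by
    refine setIntegral_congr_fun measurableSet_Ioo fun u hu => ?_
    rw [integral_mul_const, primitive_sub hψ hK hφ hu.1.le hu.2.le hx.2.le,
      Real.rpow_neg (by linarith [hu.2]), div_eq_mul_inv]
  have iψ : IntegrableOn ψ (Ioo 0 x) :=
    Measure.integrableOn_of_bounded (M := K) (by simp) hψ.aestronglyMeasurable (ae_of_all _ hK)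
  have iψr : IntegrableOn (fun w => ψ w * (x - w) ^ (-β)) (Ioo 0 x) :=
    (integrableOn_sub_right_rpow (s := -β) (by linarith)).bdd_mul hψ.aestronglyMeasurable
      (ae_of_all _ hK)
  have e2 : ∫ w in Ioo 0 x, ∫ u in Ioo 0 w, ψ w * (x - u) ^ (-(1 + β)) =
      β⁻¹ * ((∫ w in Ioo 0 x, ψ w * (x - w) ^ (-β)) - (∫ w in Ioo 0 x, ψ w) * x ^ (-β)) := by
    rw [← integral_mul_const, ← integral_sub iψr (iψ.mul_const _), ← integral_const_mul]
    refine setIntegral_congr_fun measurableSet_Ioo fun w hw => ?_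
    rw [integral_const_mul, away w hw]
    ring
  rw [e1, ← hsw, e2, ← hφ x ⟨hx.1.le, hx.2.le⟩, sub_zero, mul_inv_cancel_left₀ h0.ne',
    Real.rpow_neg hx.1.le]
  ring

end Forward

section Backward

/-- The bracket in the Weyl form of the backward derivative. -/
def backwardWeyl (β t : ℝ) (G : ℝ → ℝ) (x : ℝ) : ℝ :=
  G x / (t - x) ^ (1 - β) + (1 - β) * ∫ u in Ioo x t, (G x - G u) / (u - x) ^ (2 - β)

variable {β t K C lam : ℝ} {G γ : ℝ → ℝ}

/-- Fubini replaces the kernel `(u - x)^(β-2)` by its integral over `(w, t)`; the resulting term in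
`(t - x)^(β-1)` cancels the boundary term of the Weyl form. -/
theorem backwardWeyl_of_primitive (h0 : 0 < β) (h1 : β < 1) (hγ : Measurable γ)
    (hK : ∀ u, |γ u| ≤ K) (hG : ∀ x ≤ t, G x = -∫ u in Ioo x t, γ u) {x : ℝ} (hx : x < t) :
    backwardWeyl β t G x = -∫ y in Ioo x t, γ y * (y - x) ^ (β - 1) := by
  have hK0 : 0 ≤ K := (abs_nonneg _).trans (hK 0)
  have hi : ∀ a b, IntervalIntegrable γ volume a b := fun a b =>
    (intervalIntegrable_const (c := K)).mono_fun' hγ.aestronglyMeasurable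
      (ae_of_all _ fun x => hK x)
  have hsub : ∀ u ∈ Ioo x t, G x - G u = -∫ w in Ioo x u, γ w := by
    intro u hu
    rw [hG x hx.le, hG u hu.2.le]
    simp only [← integral_Ioc_eq_integral_Ioo]
    rw [← intervalIntegral.integral_of_le hx.le, ← intervalIntegral.integral_of_le hu.2.le,
      ← intervalIntegral.integral_of_le hu.1.le,
      ← intervalIntegral.integral_add_adjacent_intervals (hi x u) (hi u t)]
    ring
  have away : ∀ w ∈ Ioo x t, ∫ u in Ioo w t, (u - x) ^ (β - 2) =
      ((w - x) ^ (β - 1) - (t - x) ^ (β - 1)) / (1 - β) := by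
    intro w hw
    rw [setIntegral_rpow_away_left (by linarith) hw.2.le hw.1,
      show β - 2 + 1 = -(1 - β) by ring, div_neg, ← neg_div, neg_sub, neg_sub]
  have hsw := integral_triangle_swap (a := x) (b := t)
    (F := fun w u => γ w * (u - x) ^ (β - 2)) (k := fun u => K * (u - x) ^ (β - 1))
    (by unfold Function.uncurry; fun_prop)
    ((integrableOn_sub_left_rpow (by linarith)).const_mul _) (by
      intro u hu
      have hux : 0 < u - x := by linarith [hu.1]
      refine (setLIntegral_enorm_le_ofReal measurableSet_Ioo
        (h := fun _ => K * (u - x) ^ (β - 2)) (integrableOn_const (by simp)) fun w hw => ?_).trans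
        (ENNReal.ofReal_le_ofReal ?_)
      · rw [abs_mul, abs_of_nonneg (by positivity : 0 ≤ (u - x) ^ (β - 2))]
        gcongr
        exact hK w
      · simp only [setIntegral_const, smul_eq_mul, Measure.real, Real.volume_Ioo,
          ENNReal.toReal_ofReal hux.le]
        have : (u - x) ^ (β - 1) = (u - x) ^ (β - 2) * (u - x) := by
          rw [← Real.rpow_add_one hux.ne']; congr 1; ring
        rw [this]
        exact le_of_eq (by ring))
  have e1 : ∫ u in Ioo x t, (G x - G u) / (u - x) ^ (2 - β) =
      -∫ u in Ioo x t, ∫ w in Ioo x u, γ w * (u - x) ^ (β - 2) := by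
    rw [← integral_neg]
    refine setIntegral_congr_fun measurableSet_Ioo fun u hu => ?_
    rw [integral_mul_const, hsub u hu, show β - 2 = -(2 - β) by ring,
      Real.rpow_neg (by linarith [hu.1]), div_eq_mul_inv]
    ring
  have iγ : IntegrableOn γ (Ioo x t) :=
    Measure.integrableOn_of_bounded (M := K) (by simp) hγ.aestronglyMeasurable (ae_of_all _ hK)
  have iγr : IntegrableOn (fun w => γ w * (w - x) ^ (β - 1)) (Ioo x t) :=
    (integrableOn_sub_left_rpow (s := β - 1) (by linarith)).bdd_mul hγ.aestronglyMeasurable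
      (ae_of_all _ hK)
  have e2 : ∫ w in Ioo x t, ∫ u in Ioo w t, γ w * (u - x) ^ (β - 2) =
      (1 - β)⁻¹ * ((∫ w in Ioo x t, γ w * (w - x) ^ (β - 1)) -
        (∫ w in Ioo x t, γ w) * (t - x) ^ (β - 1)) := by
    rw [← integral_mul_const, ← integral_sub iγr (iγ.mul_const _), ← integral_const_mul]
    refine setIntegral_congr_fun measurableSet_Ioo fun w hw => ?_
    rw [integral_const_mul, away w hw]
    ring
  have h1' : 1 - β ≠ 0 := by linarith
  rw [backwardWeyl, e1, hsw, e2, hG x hx.le, show β - 1 = -(1 - β) by ring,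
    Real.rpow_neg (by linarith : 0 ≤ t - x)]
  field_simp
  ring

/-- The exponent `lam + β - 2` exceeds `-1` exactly when `lam > 1 - β`, the condition under which
the backward derivative exists. -/
theorem abs_backward_integrand_le (hG : ∀ x y, |G x - G y| ≤ C * |x - y| ^ lam) {x u : ℝ}
    (hu : x < u) : |(G x - G u) / (u - x) ^ (2 - β)| ≤ C * (u - x) ^ (lam + β - 2) := by
  have hd : 0 < u - x := by linarith
  rw [abs_div, abs_of_pos (by positivity : 0 < (u - x) ^ (2 - β)), div_le_iff₀ (by positivity),
    mul_assoc, ← Real.rpow_add hd, show lam + β - 2 + (2 - β) = lam by ring]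
  simpa [abs_sub_comm x u, abs_of_pos hd] using hG x u

theorem integrableOn_backward (hl : 1 - β < lam) (hGc : Continuous G)
    (hG : ∀ x y, |G x - G y| ≤ C * |x - y| ^ lam) (x : ℝ) :
    IntegrableOn (fun u => (G x - G u) / (u - x) ^ (2 - β)) (Ioo x t) := by
  refine ((integrableOn_sub_left_rpow (s := lam + β - 2) (by linarith)).const_mul C).mono'
    (have := hGc.measurable; Measurable.aestronglyMeasurable (by fun_prop)) ?_
  filter_upwards [ae_restrict_mem measurableSet_Ioo] with u hu
  exact abs_backward_integrand_le hG hu.1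

/-- The bound sees `G` only through its Hölder constant, so it is uniform along approximations and
can dominate them. -/
theorem abs_backwardWeyl_le (h1 : β < 1) (hl : 1 - β < lam)
    (hG : ∀ x y, |G x - G y| ≤ C * |x - y| ^ lam) (hGt : G t = 0) {x : ℝ} (hx : x < t) :
    |backwardWeyl β t G x| ≤ C * (1 + (1 - β) / (lam + β - 1)) * (t - x) ^ (lam + β - 1) := by
  have hd : 0 < t - x := by linarith
  have b1 : |G x / (t - x) ^ (1 - β)| ≤ C * (t - x) ^ (lam + β - 1) := by
    rw [abs_div, abs_of_pos (by positivity : 0 < (t - x) ^ (1 - β)), div_le_iff₀ (by positivity),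
      mul_assoc, ← Real.rpow_add hd, show lam + β - 1 + (1 - β) = lam by ring]
    simpa [hGt, abs_sub_comm x t, abs_of_pos hd] using hG x t
  have b2 : |∫ u in Ioo x t, (G x - G u) / (u - x) ^ (2 - β)| ≤
      C * ((t - x) ^ (lam + β - 1) / (lam + β - 1)) := by
    have hi := (integrableOn_sub_left_rpow (a := x) (b := t) (s := lam + β - 2)
      (by linarith)).const_mul C
    refine (norm_integral_le_of_norm_le (f := fun u => (G x - G u) / (u - x) ^ (2 - β)) hi
      ?_).trans (le_of_eq ?_)
    · filter_upwards [ae_restrict_mem measurableSet_Ioo] with u hu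
      exact abs_backward_integrand_le hG hu.1
    · rw [integral_const_mul, setIntegral_sub_left_rpow (by linarith) hx.le,
        show lam + β - 2 + 1 = lam + β - 1 by ring]
  calc |backwardWeyl β t G x| ≤ C * (t - x) ^ (lam + β - 1) +
        (1 - β) * (C * ((t - x) ^ (lam + β - 1) / (lam + β - 1))) := by
        refine (abs_add_le _ _).trans (add_le_add b1 ?_)
        rw [abs_mul, abs_of_pos (by linarith : 0 < 1 - β)]
        exact mul_le_mul_of_nonneg_left b2 (by linarith)
    _ = _ := by ring

theorem tendsto_backwardWeyl (hl : 1 - β < lam) {Gn : ℕ → ℝ → ℝ} (hGc : ∀ n, Continuous (Gn n))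
    (hGn : ∀ n x y, |Gn n x - Gn n y| ≤ C * |x - y| ^ lam)
    (hlim : ∀ x, Tendsto (fun n => Gn n x) atTop (𝓝 (G x))) (x : ℝ) :
    Tendsto (fun n => backwardWeyl β t (Gn n) x) atTop (𝓝 (backwardWeyl β t G x)) := by
  refine ((hlim x).div_const _).add (Tendsto.const_mul _ ?_)
  refine tendsto_integral_of_dominated_convergence (fun u => C * (u - x) ^ (lam + β - 2))
    (fun n => (integrableOn_backward hl (hGc n) (hGn n) x).aestronglyMeasurable)
    ((integrableOn_sub_left_rpow (by linarith)).const_mul C) (fun n => ?_) ?_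
  · filter_upwards [ae_restrict_mem measurableSet_Ioo] with u hu
    exact abs_backward_integrand_le (hGn n) hu.1
  · exact ae_of_all _ fun u => (((hlim x).sub (hlim u)).div_const _)

theorem measurable_backwardWeyl (hG : Continuous G) : Measurable (backwardWeyl β t G) := by
  have := hG.measurable
  have h := measurable_setIntegral_Ioo_left (F := fun x u => (G x - G u) / (u - x) ^ (2 - β))
    (by unfold Function.uncurry; fun_prop) t
  unfold backwardWeyl
  fun_prop

end Backward
end

/-! ### Inversion of the backward derivative and integration by parts. -/

noncomputable section

section Smoothing

/-- Forward moving average over a window of length `ε`. -/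
def forwardMean (ε : ℝ) (G : ℝ → ℝ) (x : ℝ) : ℝ := ε⁻¹ * ∫ r in (0 : ℝ)..ε, G (x + r)

variable {β t C K lam ε : ℝ} {G γ : ℝ → ℝ}

theorem continuous_forwardMean (hG : Continuous G) : Continuous (forwardMean ε G) := by
  unfold forwardMean
  refine continuous_const.mul ?_
  exact intervalIntegral.continuous_parametric_intervalIntegral_of_continuous'
    (by unfold Function.uncurry; fun_prop) 0 ε

/-- Averaging is a contraction. With `F = G` it preserves Hölder constants; with `F` constant it
gives the approximation error. -/
theorem abs_forwardMean_sub_le (hε : 0 < ε) (hGc : Continuous G) {x y c : ℝ} {F : ℝ → ℝ}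
    (hF : Continuous F) (h : ∀ r ∈ Icc 0 ε, |G (x + r) - F (y + r)| ≤ c) :
    |forwardMean ε G x - forwardMean ε F y| ≤ c := by
  have hi : ∀ {G : ℝ → ℝ}, Continuous G → ∀ x, IntervalIntegrable (fun r => G (x + r)) volume 0 ε :=
    fun hG x => (by fun_prop : Continuous fun r => _).intervalIntegrable _ _
  unfold forwardMean
  rw [← mul_sub, ← intervalIntegral.integral_sub (hi hGc x) (hi hF y), abs_mul,
    abs_of_pos (by positivity : 0 < ε⁻¹)]
  have := intervalIntegral.norm_integral_le_of_norm_le_const (a := 0) (b := ε) (C := c)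
    (f := fun r => G (x + r) - F (y + r)) fun r hr => by
      rw [uIoc_of_le hε.le] at hr
      exact h r ⟨hr.1.le, hr.2⟩
  rw [sub_zero, abs_of_pos hε, Real.norm_eq_abs] at this
  rw [inv_mul_le_iff₀ hε, mul_comm]
  exact this

theorem forwardMean_const (hε : 0 < ε) (c x : ℝ) : forwardMean ε (fun _ => c) x = c := by
  simp [forwardMean, hε.ne']

theorem tendsto_forwardMean (hGc : Continuous G) (hl : 0 < lam)
    (hG : ∀ x y, |G x - G y| ≤ C * |x - y| ^ lam) (hC : 0 ≤ C) (x : ℝ) :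
    Tendsto (fun n : ℕ => forwardMean (1 / ((n : ℝ) + 1)) G x) atTop (𝓝 (G x)) := by
  have h1 : Tendsto (fun n : ℕ => C * (1 / ((n : ℝ) + 1)) ^ lam) atTop (𝓝 0) := by
    have := ((tendsto_one_div_add_atTop_nhds_zero_nat (𝕜 := ℝ)).rpow_const
      (Or.inr hl.le)).const_mul C
    rwa [Real.zero_rpow hl.ne', mul_zero] at this
  rw [tendsto_iff_dist_tendsto_zero]
  refine squeeze_zero (fun _ => dist_nonneg) (fun n => ?_) h1
  have hε : 0 < 1 / ((n : ℝ) + 1) := by positivity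
  have := abs_forwardMean_sub_le (x := x) (y := x) hε hGc (F := fun _ => G x) continuous_const
    (c := C * (1 / ((n : ℝ) + 1)) ^ lam) fun r hr => by
      refine (hG _ _).trans ?_
      rw [add_sub_cancel_left, abs_of_nonneg hr.1]
      exact mul_le_mul_of_nonneg_left (Real.rpow_le_rpow hr.1 hr.2 hl.le) hC
  rwa [forwardMean_const hε] at this

theorem forwardMean_sub (hGc : Continuous G) (a b : ℝ) :
    forwardMean ε G b - forwardMean ε G a = ∫ u in a..b, ε⁻¹ * (G (u + ε) - G u) := by
  have hi : ∀ a b, IntervalIntegrable G volume a b := fun a b => hGc.intervalIntegrable a b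
  rw [intervalIntegral.integral_const_mul, intervalIntegral.integral_sub
      ((by fun_prop : Continuous fun u => G (u + ε)).intervalIntegrable _ _) (hi _ _),
    intervalIntegral.integral_comp_add_right, forwardMean, forwardMean,
    intervalIntegral.integral_comp_add_left, intervalIntegral.integral_comp_add_left, add_zero,
    add_zero]
  have h1 := intervalIntegral.integral_add_adjacent_intervals (hi a (a + ε)) (hi (a + ε) (b + ε))
  have h2 := intervalIntegral.integral_add_adjacent_intervals (hi a b) (hi b (b + ε))
  linear_combination ε⁻¹ * (h2 - h1)

theorem forwardMean_eq_primitive (hGc : Continuous G) (hGt : ∀ x, t ≤ x → G x = 0) (hε : 0 < ε)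
    {x : ℝ} (hx : x ≤ t) :
    forwardMean ε G x = -∫ u in Ioo x t, ε⁻¹ * (G (u + ε) - G u) := by
  have h0 : forwardMean ε G t = 0 := by
    have : ∀ r ∈ Icc 0 ε, |G (t + r) - 0| ≤ 0 := fun r hr => by
      rw [hGt _ (by linarith [hr.1])]; simp
    have := abs_forwardMean_sub_le (y := t) hε hGc (F := fun _ => 0) continuous_const this
    rw [forwardMean_const hε, sub_zero] at this
    exact abs_nonpos_iff.1 this
  rw [← integral_Ioc_eq_integral_Ioo, ← intervalIntegral.integral_of_le hx,
    ← forwardMean_sub hGc, h0]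
  ring

end Smoothing

section Inversion

variable {β t C K lam : ℝ} {G γ : ℝ → ℝ}

/-- After Fubini the inner integral is the beta kernel, which depends on neither endpoint, so only
the integral of `γ` over `(u, t)` remains. -/
theorem fractionalIntegral_backwardWeyl_of_primitive (h0 : 0 < β) (h1 : β < 1) (hγ : Measurable γ)
    (hK : ∀ u, |γ u| ≤ K) (hG : ∀ x ≤ t, G x = -∫ u in Ioo x t, γ u) {u : ℝ} (hu : u < t) :
    ∫ x in Ioo u t, (x - u) ^ (-β) * backwardWeyl β t G x =
      Real.Gamma (1 - β) * Real.Gamma β * G u := by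
  have hsw := integral_triangle_swap (a := u) (b := t)
    (F := fun x y => γ y * ((x - u) ^ (-β) * (y - x) ^ (β - 1)))
    (k := fun _ => K * (Real.Gamma (1 - β) * Real.Gamma β))
    (by unfold Function.uncurry; fun_prop) (integrableOn_const (by simp)) (by
      intro y hy
      obtain ⟨hi, hv⟩ := betaKernel h0 h1 hy.1
      refine (setLIntegral_enorm_le_ofReal measurableSet_Ioo (hi.const_mul K) fun x hx => ?_).trans
        (ENNReal.ofReal_le_ofReal ?_)
      · have p1 : 0 ≤ (x - u) ^ (-β) * (y - x) ^ (β - 1) :=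
          mul_nonneg (Real.rpow_nonneg (by linarith [hx.1]) _)
            (Real.rpow_nonneg (by linarith [hx.2]) _)
        rw [abs_mul, abs_of_nonneg p1]
        exact mul_le_mul_of_nonneg_right (hK y) p1
      · rw [integral_const_mul, hv])
  have e1 : ∫ x in Ioo u t, (x - u) ^ (-β) * backwardWeyl β t G x =
      -∫ x in Ioo u t, ∫ y in Ioo x t, γ y * ((x - u) ^ (-β) * (y - x) ^ (β - 1)) := by
    rw [← integral_neg]
    refine setIntegral_congr_fun measurableSet_Ioo fun x hx => ?_
    rw [backwardWeyl_of_primitive h0 h1 hγ hK hG hx.2, mul_neg, ← integral_const_mul]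
    congr 2
    ext y
    ring
  have e2 : ∫ y in Ioo u t, ∫ x in Ioo u y, γ y * ((x - u) ^ (-β) * (y - x) ^ (β - 1)) =
      (∫ y in Ioo u t, γ y) * (Real.Gamma (1 - β) * Real.Gamma β) := by
    rw [← integral_mul_const]
    refine setIntegral_congr_fun measurableSet_Ioo fun y hy => ?_
    rw [integral_const_mul, (betaKernel h0 h1 hy.1).2]
  rw [e1, ← hsw, e2, hG u hu.le]
  ring

/-- The fractional integral inverts the backward Weyl derivative on Hölder functions. -/
theorem fractionalIntegral_backwardWeyl (h0 : 0 < β) (h1 : β < 1) (hl : 1 - β < lam) (hC : 0 ≤ C)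
    (hGc : Continuous G) (hG : ∀ x y, |G x - G y| ≤ C * |x - y| ^ lam)
    (hGt : ∀ x, t ≤ x → G x = 0) {u : ℝ} (hu : u < t) :
    ∫ x in Ioo u t, (x - u) ^ (-β) * backwardWeyl β t G x =
      Real.Gamma (1 - β) * Real.Gamma β * G u := by
  -- The means are primitives of bounded functions, vanish at `t` and keep the Hölder constant `C`.
  -- The identity holds for each of them and passes to the limit by dominated convergence.
  let Gn : ℕ → ℝ → ℝ := fun n => forwardMean (1 / ((n : ℝ) + 1)) G
  have hε : ∀ n : ℕ, 0 < 1 / ((n : ℝ) + 1) := fun n => by positivity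
  have hlim : ∀ x, Tendsto (fun n => Gn n x) atTop (𝓝 (G x)) :=
    tendsto_forwardMean hGc (by linarith) hG hC
  have hGnc : ∀ n, Continuous (Gn n) := fun n => continuous_forwardMean hGc
  have hGn : ∀ n x y, |Gn n x - Gn n y| ≤ C * |x - y| ^ lam := fun n x y =>
    abs_forwardMean_sub_le (hε n) hGc hGc fun r _ => by
      simpa [add_sub_add_right_eq_sub] using hG (x + r) (y + r)
  have hGb : ∀ n, Gn n t = 0 := fun n => by
    simp only [Gn]
    rw [forwardMean_eq_primitive hGc hGt (hε n) le_rfl]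
    simp
  have hn : ∀ n, ∫ x in Ioo u t, (x - u) ^ (-β) * backwardWeyl β t (Gn n) x =
      Real.Gamma (1 - β) * Real.Gamma β * Gn n u := by
    intro n
    refine fractionalIntegral_backwardWeyl_of_primitive h0 h1
      (γ := fun u => (1 / ((n : ℝ) + 1))⁻¹ * (G (u + 1 / ((n : ℝ) + 1)) - G u))
      (K := (1 / ((n : ℝ) + 1))⁻¹ * (C * (1 / ((n : ℝ) + 1)) ^ lam))
      (by fun_prop) (fun u => ?_) (fun x hx => forwardMean_eq_primitive hGc hGt (hε n) hx) hu
    rw [abs_mul, abs_of_pos (inv_pos.2 (hε n))]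
    refine mul_le_mul_of_nonneg_left ?_ (inv_pos.2 (hε n)).le
    have := hG (u + 1 / ((n : ℝ) + 1)) u
    rwa [add_sub_cancel_left, abs_of_pos (hε n)] at this
  refine tendsto_nhds_unique ?_ ((hlim u).const_mul (Real.Gamma (1 - β) * Real.Gamma β))
  simp_rw [← hn]
  set M := C * (1 + (1 - β) / (lam + β - 1)) with hM
  have hM0 : 0 ≤ M := mul_nonneg hC (add_nonneg zero_le_one (div_nonneg (by linarith) (by linarith)))
  refine tendsto_integral_of_dominated_convergence
    (fun x => (x - u) ^ (-β) * (M * (t - u) ^ (lam + β - 1)))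
    (fun n => ?_) ((integrableOn_sub_left_rpow (by linarith)).mul_const _) (fun n => ?_) ?_
  · have := measurable_backwardWeyl (β := β) (t := t) (hGnc n)
    exact Measurable.aestronglyMeasurable (by fun_prop)
  · filter_upwards [ae_restrict_mem measurableSet_Ioo] with x hx
    have p1 : 0 ≤ (x - u) ^ (-β) := Real.rpow_nonneg (by linarith [hx.1]) _
    rw [Real.norm_eq_abs, abs_mul, abs_of_nonneg p1]
    refine mul_le_mul_of_nonneg_left ?_ p1
    refine (abs_backwardWeyl_le h1 hl (hGn n) (hGb n) hx.2).trans ?_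
    exact mul_le_mul_of_nonneg_left (Real.rpow_le_rpow (by linarith [hx.2]) (by linarith [hx.1])
      (by linarith)) hM0
  · exact ae_of_all _ fun x => (tendsto_backwardWeyl hl hGnc hGn hlim x).const_mul _

end Inversion

section Integral

variable {β t C K lam : ℝ} {g ψ φ : ℝ → ℝ}

theorem glsNorm_lt_top_of_primitive (h1 : β < 1) (hψ : Measurable ψ)
    (hK : ∀ u, |ψ u| ≤ K) (hφ : ∀ x ∈ Icc 0 t, φ x = ∫ u in Ioo 0 x, ψ u) :
    glsNorm β φ 0 t < ∞ := by
  have hK0 : 0 ≤ K := (abs_nonneg _).trans (hK 0)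
  have hb : ∀ s ∈ Ioo 0 t, (ENNReal.ofReal (|φ s| / (s - 0) ^ β) +
      ∫⁻ z in Ioo 0 s, ENNReal.ofReal (|φ s - φ z| / (s - z) ^ (1 + β))) ≤
      ENNReal.ofReal (K * t ^ (1 - β)) + ENNReal.ofReal (K * (t ^ (1 - β) / (1 - β))) := by
    intro s hs
    have hst : s ^ (1 - β) ≤ t ^ (1 - β) := Real.rpow_le_rpow hs.1.le hs.2.le (by linarith)
    refine add_le_add (ENNReal.ofReal_le_ofReal ?_) ?_
    · have h := abs_primitive_sub_le hψ hK hφ le_rfl hs.1.le hs.2.le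
      have z : φ 0 = 0 := by rw [hφ 0 ⟨le_rfl, (hs.1.trans hs.2).le⟩]; simp
      rw [z, sub_zero, sub_zero] at h
      have hs0 := hs.1
      rw [sub_zero, div_le_iff₀ (by positivity)]
      calc |φ s| ≤ K * s := h
        _ = K * s ^ (1 - β) * s ^ β := by
          rw [mul_assoc, ← Real.rpow_add hs0, sub_add_cancel, Real.rpow_one]
        _ ≤ _ := by gcongr
    · have hi := (integrableOn_sub_right_rpow (a := 0) (b := s) (s := -β) (by linarith)).const_mul K
      have h2 := setLIntegral_enorm_le_ofReal measurableSet_Ioo hi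
        (f := fun z => |φ s - φ z| / (s - z) ^ (1 + β)) fun z hz => by
          rw [abs_of_nonneg (div_nonneg (abs_nonneg _) (Real.rpow_nonneg (by linarith [hz.2]) _))]
          exact abs_primitive_div_le hψ hK hφ hz.1.le hz.2 hs.2.le
      refine (setLIntegral_mono' measurableSet_Ioo fun z hz => ?_).trans (h2.trans
        (ENNReal.ofReal_le_ofReal ?_))
      · exact Real.ofReal_le_enorm _
      · rw [integral_const_mul, setIntegral_sub_right_rpow (by linarith) hs.1.le, sub_zero,
          show -β + 1 = 1 - β by ring]
        have : 0 < 1 - β := by linarith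
        gcongr
  refine (setLIntegral_mono' measurableSet_Ioo hb).trans_lt ?_
  rw [setLIntegral_const]
  exact ENNReal.mul_lt_top (by simp) (by simp)

/-- The generalized Lebesgue–Stieltjes integral of a Lipschitz function vanishing at the origin
against a Hölder function exists and is given by integration by parts. -/
theorem gls_of_primitive (h0 : 0 < β) (h1 : β < 1) (hl : 1 - β < lam) (hC : 0 ≤ C)
    (hgc : Continuous g) (hg : ∀ x y, |g x - g y| ≤ C * |x - y| ^ lam) (hψ : Measurable ψ)
    (hK : ∀ u, |ψ u| ≤ K) (hφ : ∀ x ∈ Icc 0 t, φ x = ∫ u in Ioo 0 x, ψ u) :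
    GLSIntegrable β φ g 0 t ∧
      glsIntegral β φ g 0 t = ∫ u in Ioo 0 t, ψ u * (g t - g u) := by
  have hK0 : 0 ≤ K := (abs_nonneg _).trans (hK 0)
  have hll : Function.leftLim g t = g t := hgc.continuousAt.continuousWithinAt.leftLim_eq
  -- Stopping `g` at `t` changes nothing on `(0, t)` and gives a globally Hölder function that
  -- vanishes from `t` on, as the inversion formula requires.
  let G : ℝ → ℝ := fun x => g (min x t) - g t
  have hGc : Continuous G := by fun_prop
  have hG : ∀ x y, |G x - G y| ≤ C * |x - y| ^ lam := by
    intro x y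
    simp only [G, sub_sub_sub_cancel_right]
    refine (hg _ _).trans (mul_le_mul_of_nonneg_left (Real.rpow_le_rpow (abs_nonneg _) ?_
      (by linarith)) hC)
    simpa using abs_min_sub_min_le_max x t y t
  have hGt : ∀ x, t ≤ x → G x = 0 := fun x hx => by simp [G, min_eq_right hx]
  have hGl : ∀ x ≤ t, leftCentered t g x = G x := fun x hx => by
    simp [G, leftCentered, hll, min_eq_left hx]
  have eB : ∀ x ∈ Ioo 0 t, backwardDeriv β t (leftCentered t g) x =
      1 / Real.Gamma β * backwardWeyl β t G x := by
    intro x hx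
    rw [backwardDeriv, backwardWeyl, hGl x hx.2.le]
    congr 3
    refine setIntegral_congr_fun measurableSet_Ioo fun u hu => ?_
    rw [hGl u hu.2.le]
  let A : ℝ → ℝ := fun x => ∫ u in Ioo 0 x, ψ u * (x - u) ^ (-β)
  have eA : ∀ x ∈ Ioo 0 t, forwardDeriv β 0 φ x = 1 / Real.Gamma (1 - β) * A x := by
    intro x hx
    rw [forwardDeriv, forward_weyl h0 h1 hψ hK hφ hx]
  have mA : Measurable A := measurable_setIntegral_Ioo_right
    (F := fun x u => ψ u * (x - u) ^ (-β)) (by unfold Function.uncurry; fun_prop) 0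
  have mB : Measurable (backwardWeyl β t G) := measurable_backwardWeyl hGc
  set M := C * (1 + (1 - β) / (lam + β - 1)) * t ^ (lam + β - 1) with hM
  have hM' : 0 ≤ C * (1 + (1 - β) / (lam + β - 1)) :=
    mul_nonneg hC (add_nonneg zero_le_one (div_nonneg (by linarith) (by linarith)))
  have bB : ∀ x ∈ Ioo 0 t, |backwardWeyl β t G x| ≤ M := fun x hx =>
    (abs_backwardWeyl_le h1 hl hG (hGt t le_rfl) hx.2).trans
      (mul_le_mul_of_nonneg_left (Real.rpow_le_rpow (by linarith [hx.2]) (by linarith [hx.1])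
        (by linarith)) hM')
  have iK : ∀ x, IntegrableOn (fun u => K * (x - u) ^ (-β)) (Ioo 0 x) := fun x =>
    (integrableOn_sub_right_rpow (by linarith)).const_mul K
  have vK : ∀ x ∈ Ioo 0 t, ∫ u in Ioo 0 x, K * (x - u) ^ (-β) ≤ K * (t ^ (1 - β) / (1 - β)) := by
    intro x hx
    rw [integral_const_mul, setIntegral_sub_right_rpow (by linarith) hx.1.le, sub_zero,
      show -β + 1 = 1 - β by ring]
    have h1' : 0 < 1 - β := by linarith
    have := hx.1.le
    gcongr
    exact hx.2.le
  have bψ : ∀ x u, u < x → |ψ u * (x - u) ^ (-β)| ≤ K * (x - u) ^ (-β) := fun x u hu => by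
    have p1 : 0 ≤ (x - u) ^ (-β) := Real.rpow_nonneg (by linarith) _
    rw [abs_mul, abs_of_nonneg p1]
    exact mul_le_mul_of_nonneg_right (hK u) p1
  have bA : ∀ x ∈ Ioo 0 t, |A x| ≤ K * (t ^ (1 - β) / (1 - β)) := fun x hx => by
    refine (norm_integral_le_of_norm_le (f := fun u => ψ u * (x - u) ^ (-β)) (iK x) ?_).trans
      (vK x hx)
    filter_upwards [ae_restrict_mem measurableSet_Ioo] with u hu
    exact bψ x u hu.2
  have hprod : ∀ x ∈ Ioo 0 t, forwardDeriv β 0 φ x * backwardDeriv β t (leftCentered t g) x =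
      1 / Real.Gamma (1 - β) * (1 / Real.Gamma β) * (A x * backwardWeyl β t G x) := by
    intro x hx
    rw [eA x hx, eB x hx]
    ring
  have iAB : IntegrableOn (fun x => A x * backwardWeyl β t G x) (Ioo 0 t) := by
    refine Measure.integrableOn_of_bounded (M := K * (t ^ (1 - β) / (1 - β)) * M) (by simp)
      (mA.mul mB).aestronglyMeasurable ?_
    filter_upwards [ae_restrict_mem measurableSet_Ioo] with x hx
    rw [Real.norm_eq_abs, abs_mul]
    exact mul_le_mul (bA x hx) (bB x hx) (abs_nonneg _) ((abs_nonneg _).trans (bA x hx))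
  refine ⟨⟨?_, ?_, ?_⟩, ?_⟩
  · filter_upwards [ae_restrict_mem measurableSet_Ioo] with x hx
    exact integrableOn_forward h1 hψ hK hφ hx
  · filter_upwards [ae_restrict_mem measurableSet_Ioo] with x hx
    refine (integrableOn_congr_fun (fun u hu => ?_) measurableSet_Ioo).1
      (integrableOn_backward (t := t) hl hGc hG x)
    rw [hGl x hx.2.le, hGl u hu.2.le]
  · exact (integrableOn_congr_fun hprod measurableSet_Ioo).2 (iAB.const_mul _)
  -- Moving the fractional kernel from `ψ` to the backward derivative lets the inversion formula
  -- collapse the inner integral; the Gamma factors cancel.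
  · have hsw := integral_triangle_swap (a := 0) (b := t)
      (F := fun u x => ψ u * ((x - u) ^ (-β) * backwardWeyl β t G x))
      (k := fun _ => K * (t ^ (1 - β) / (1 - β)) * M)
      (by unfold Function.uncurry; fun_prop) (integrableOn_const (by simp)) (by
        intro x hx
        refine (setLIntegral_enorm_le_ofReal measurableSet_Ioo ((iK x).mul_const M)
          fun u hu => ?_).trans (ENNReal.ofReal_le_ofReal ?_)
        · rw [← mul_assoc, abs_mul]
          exact mul_le_mul (bψ x u hu.2) (bB x hx) (abs_nonneg _)
            ((abs_nonneg _).trans (bψ x u hu.2))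
        · rw [integral_mul_const]
          exact mul_le_mul_of_nonneg_right (vK x hx) ((abs_nonneg _).trans (bB x hx)))
    have e1 : ∫ x in Ioo 0 t, A x * backwardWeyl β t G x =
        ∫ x in Ioo 0 t, ∫ u in Ioo 0 x, ψ u * ((x - u) ^ (-β) * backwardWeyl β t G x) := by
      refine setIntegral_congr_fun measurableSet_Ioo fun x hx => ?_
      simp only [A]
      rw [← integral_mul_const]
      simp_rw [mul_assoc]
    have hg1 := (Real.Gamma_pos_of_pos (by linarith : 0 < 1 - β)).ne'
    have hg2 := (Real.Gamma_pos_of_pos h0).ne'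
    rw [glsIntegral, setIntegral_congr_fun measurableSet_Ioo hprod, integral_const_mul, e1, hsw,
      ← integral_const_mul, ← integral_neg]
    refine setIntegral_congr_fun measurableSet_Ioo fun u hu => ?_
    rw [integral_const_mul, fractionalIntegral_backwardWeyl h0 h1 hl hC hGc hG hGt hu.2]
    simp only [G, min_eq_left hu.2.le]
    field_simp
    ring

end Integral
end

/-! ### Gain of the sine integrand over a grid of cells. -/

noncomputable section

/-- A second-order Taylor bound without smallness of `b`: for `|b| > 1` the sine is simply bounded.
The constant is crude. -/
theorem abs_cos_sub_cos_add_sub_le (a b : ℝ) :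
    |Real.cos a - Real.cos (a + b) - Real.sin a * b| ≤ 3 * b ^ 2 := by
  have hs : |Real.sin b - b| ≤ 2 * b ^ 2 := by
    rcases le_or_gt |b| 1 with h | h
    · have h1 := Real.sin_bound h
      have e : Real.sin b - b = (Real.sin b - (b - b ^ 3 / 6)) - b ^ 3 / 6 := by ring
      have h3 : |b ^ 3 / 6| ≤ b ^ 2 := by
        rw [abs_div, abs_pow, ← sq_abs b, abs_of_pos (by norm_num : (0 : ℝ) < 6)]
        nlinarith [abs_nonneg b, pow_nonneg (abs_nonneg b) 2]
      have h5 : |b| ^ 5 / 100 ≤ b ^ 2 := by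
        rw [← sq_abs b]
        have := pow_le_pow_of_le_one (abs_nonneg b) h (by norm_num : 2 ≤ 5)
        nlinarith [pow_nonneg (abs_nonneg b) 2]
      rw [e]
      exact (abs_sub _ _).trans (by linarith)
    · have := Real.abs_sin_le_one b
      refine (abs_sub _ _).trans ?_
      rw [← sq_abs b]
      nlinarith
  have hc : |1 - Real.cos b| ≤ b ^ 2 / 2 := by
    rw [abs_of_nonneg (by linarith [Real.cos_le_one b])]
    linarith [Real.one_sub_sq_div_two_le_cos (x := b)]
  have e : Real.cos a - Real.cos (a + b) - Real.sin a * b =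
      Real.cos a * (1 - Real.cos b) + Real.sin a * (Real.sin b - b) := by
    rw [Real.cos_add]; ring
  rw [e]
  refine (abs_add_le _ _).trans ?_
  rw [abs_mul, abs_mul]
  have h1 := mul_le_mul (Real.abs_cos_le_one a) hc (abs_nonneg _) zero_le_one
  have h2 := mul_le_mul (Real.abs_sin_le_one a) hs (abs_nonneg _) zero_le_one
  nlinarith [sq_nonneg b]

/-- Pathwise gain of the forward integral of `c * sin ((y - y s) / σ)` over one cell. -/
theorem abs_forward_integral_cell_sub_le {y : ℝ → ℝ} (hy : Continuous y) {s e h c σ w : ℝ}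
    (hse : s ≤ e) (hh : 0 < h) (hc : 0 ≤ c) (hσ : 0 < σ)
    (hw : ∀ r, ∀ q ∈ Icc 0 h, |y (r + q) - y r| ≤ w) :
    |(∫ r in s..e, h⁻¹ * (c * Real.sin ((y r - y s) / σ) * (y (r + h) - y r))) -
      c * σ * (1 - Real.cos ((y e - y s) / σ))| ≤
      (e - s) * (h⁻¹ * (3 * c * w ^ 2 / σ)) + 2 * (c * w) := by
  -- `Φ` is the primitive along the path: formally `dΦ = c sin ((y - y s) / σ) dy`. Replacing the
  -- integrand by the difference quotient of `Φ` costs a second-order error.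
  let Φ : ℝ → ℝ := fun r => c * σ * (1 - Real.cos ((y r - y s) / σ))
  have hΦ : Continuous Φ := by fun_prop
  have hΦl : ∀ a b, |Φ a - Φ b| ≤ c * |y a - y b| := by
    intro a b
    have h1 := Real.abs_cos_sub_cos_le ((y b - y s) / σ) ((y a - y s) / σ)
    have e1 : Φ a - Φ b = c * σ * (Real.cos ((y b - y s) / σ) - Real.cos ((y a - y s) / σ)) := by
      simp only [Φ]; ring
    have e2 : (y b - y s) / σ - (y a - y s) / σ = (y b - y a) / σ := by ring
    rw [e2, abs_div, abs_of_pos hσ, le_div_iff₀ hσ] at h1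
    rw [e1, abs_mul, abs_of_nonneg (by positivity : 0 ≤ c * σ), abs_sub_comm (y a)]
    nlinarith [mul_le_mul_of_nonneg_left h1 hc]
  -- The difference quotient of `Φ` integrates to the difference of its means at `e` and `s`. Each
  -- endpoint costs `c * w`, hence the term `2 * (c * w)`.
  have hmean : ∀ x, |forwardMean h Φ x - Φ x| ≤ c * w := by
    intro x
    have := abs_forwardMean_sub_le (x := x) (y := x) hh hΦ (F := fun _ => Φ x) continuous_const
      (c := c * w) fun r hr =>
        (hΦl _ _).trans (mul_le_mul_of_nonneg_left (hw x r hr) hc)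
    rwa [forwardMean_const hh] at this
  have hdiff : |(∫ r in s..e, h⁻¹ * (c * Real.sin ((y r - y s) / σ) * (y (r + h) - y r))) -
      ∫ r in s..e, h⁻¹ * (Φ (r + h) - Φ r)| ≤ (e - s) * (h⁻¹ * (3 * c * w ^ 2 / σ)) := by
    rw [← intervalIntegral.integral_sub
      ((by fun_prop : Continuous fun r => _).intervalIntegrable _ _)
      ((by fun_prop : Continuous fun r => _).intervalIntegrable _ _)]
    have := intervalIntegral.norm_integral_le_of_norm_le_const (a := s) (b := e)
      (f := fun r => h⁻¹ * (c * Real.sin ((y r - y s) / σ) * (y (r + h) - y r)) -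
        h⁻¹ * (Φ (r + h) - Φ r)) (C := h⁻¹ * (3 * c * w ^ 2 / σ)) fun r _ => by
      have h1 := abs_cos_sub_cos_add_sub_le ((y r - y s) / σ) ((y (r + h) - y r) / σ)
      have e1 : h⁻¹ * (c * Real.sin ((y r - y s) / σ) * (y (r + h) - y r)) -
        h⁻¹ * (Φ (r + h) - Φ r) = -(h⁻¹ * (c * σ * (Real.cos ((y r - y s) / σ) -
          Real.cos ((y r - y s) / σ + (y (r + h) - y r) / σ) -
          Real.sin ((y r - y s) / σ) * ((y (r + h) - y r) / σ)))) := by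
        have e2 : (y r - y s) / σ + (y (r + h) - y r) / σ = (y (r + h) - y s) / σ := by ring
        rw [e2]
        simp only [Φ]
        field_simp
        ring
      rw [Real.norm_eq_abs, e1, abs_neg, abs_mul, abs_of_pos (by positivity : 0 < h⁻¹)]
      refine mul_le_mul_of_nonneg_left ?_ (by positivity)
      rw [abs_mul, abs_of_nonneg (by positivity : 0 ≤ c * σ)]
      have h2 : (y (r + h) - y r) ^ 2 ≤ w ^ 2 := by
        rw [← sq_abs]
        exact pow_le_pow_left₀ (abs_nonneg _) (hw r h ⟨hh.le, le_rfl⟩) 2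
      calc _ ≤ c * σ * (3 * ((y (r + h) - y r) / σ) ^ 2) := by gcongr
        _ = 3 * c * (y (r + h) - y r) ^ 2 / σ := by field_simp
        _ ≤ _ := by gcongr
    rwa [abs_of_nonneg (by linarith : 0 ≤ e - s), mul_comm _ (e - s)] at this
  rw [← forwardMean_sub hΦ] at hdiff
  have he := hmean e
  have hs := hmean s
  have hs0 : Φ s = 0 := by simp [Φ]
  rw [hs0, sub_zero] at hs
  change |_ - Φ e| ≤ _
  rw [abs_le] at hdiff he hs ⊢
  constructor <;> linarith [hdiff.1, hdiff.2, he.1, he.2, hs.1, hs.2]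

/-- On a uniform grid of `N` cells of length `δ` starting at `T`, the function
`c * sin ((g r - g s) / σ)`, where `s` is the left end of the cell of `r`. -/
def gridSine (T δ : ℝ) (N : ℕ) (c σ : ℝ) (g : ℝ → ℝ) (r : ℝ) : ℝ :=
  (Ico T (T + N * δ)).indicator
    (fun r => c * Real.sin ((g r - g (T + ⌊(r - T) / δ⌋₊ * δ)) / σ)) r

section Grid

variable {T δ c σ h t w : ℝ} {N : ℕ} {g : ℝ → ℝ}

theorem abs_gridSine_le (hc : 0 ≤ c) (r : ℝ) : |gridSine T δ N c σ g r| ≤ c := by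
  unfold gridSine
  by_cases hr : r ∈ Ico T (T + N * δ)
  · rw [indicator_of_mem hr, abs_mul, abs_of_nonneg hc]
    exact mul_le_of_le_one_right hc (Real.abs_sin_le_one _)
  · rw [indicator_of_notMem hr, abs_zero]; exact hc

theorem measurable_gridSine (hg : Measurable g) : Measurable (gridSine T δ N c σ g) := by
  unfold gridSine
  refine Measurable.indicator ?_ measurableSet_Ico
  fun_prop

theorem gridSine_of_lt {r : ℝ} (hr : r < T) : gridSine T δ N c σ g r = 0 :=
  indicator_of_notMem (fun h => by linarith [h.1]) _

theorem gridSine_eq_of_mem_cell (hδ : 0 < δ) {j : ℕ} (hj : j < N) {r : ℝ}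
    (hr : r ∈ Ico (T + j * δ) (T + (j + 1 : ℕ) * δ)) :
    gridSine T δ N c σ g r = c * Real.sin ((g r - g (T + j * δ)) / σ) := by
  have hj' : ((j + 1 : ℕ) : ℝ) ≤ N := by exact_mod_cast hj
  have h0 : (0 : ℝ) ≤ j * δ := by positivity
  have hf : ⌊(r - T) / δ⌋₊ = j := by
    have h1 := hr.2
    push_cast at h1
    rw [Nat.floor_eq_iff (div_nonneg (by linarith [hr.1]) hδ.le), le_div_iff₀ hδ, div_lt_iff₀ hδ]
    constructor <;> linarith [hr.1]
  have hm : r ∈ Ico T (T + N * δ) :=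
    ⟨by linarith [hr.1], hr.2.trans_le (by gcongr)⟩
  rw [gridSine, indicator_of_mem hm, hf]

/-- `gridSine` at time `r` depends on the path up to `r` only. -/
theorem gridSine_comp_min (hδ : 0 < δ) {r : ℝ} (hr : r ≤ t) :
    gridSine T δ N c σ (fun x => g (min x t)) r = gridSine T δ N c σ g r := by
  unfold gridSine
  by_cases hm : r ∈ Ico T (T + N * δ)
  · have h1 : T + ⌊(r - T) / δ⌋₊ * δ ≤ r := by
      have := Nat.floor_le (div_nonneg (by linarith [hm.1] : 0 ≤ r - T) hδ.le)
      rw [le_div_iff₀ hδ] at this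
      linarith
    rw [indicator_of_mem hm, indicator_of_mem hm]
    simp only
    rw [min_eq_left hr, min_eq_left (h1.trans hr)]
  · rw [indicator_of_notMem hm, indicator_of_notMem hm]

/-- Stopping the path at `t` treats all `t` at once: cells after `t` have zero gain and a cell
containing `t` counts up to `t`. -/
theorem abs_forward_integral_grid_sub_le (hg : Continuous g) (hδ : 0 < δ) (hh : 0 < h)
    (hc : 0 ≤ c) (hσ : 0 < σ) (hw : ∀ r, ∀ q ∈ Icc 0 h, |g (min (r + q) t) - g (min r t)| ≤ w) :
    |(∫ r in T..(T + N * δ), h⁻¹ * (gridSine T δ N c σ g r * (g (min (r + h) t) - g (min r t)))) -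
      ∑ j ∈ Finset.range N, c * σ * (1 - Real.cos ((g (min (T + (j + 1 : ℕ) * δ) t) -
        g (min (T + j * δ) t)) / σ))| ≤
      N * (δ * (h⁻¹ * (3 * c * w ^ 2 / σ)) + 2 * (c * w)) := by
  let y : ℝ → ℝ := fun r => g (min r t)
  have hy : Continuous y := by fun_prop
  have hint : ∀ a b, IntervalIntegrable (fun r => h⁻¹ * (gridSine T δ N c σ g r *
      (y (r + h) - y r))) volume a b := by
    intro a b
    have h1 : IntervalIntegrable (fun r => y (r + h) - y r) volume a b :=
      (by fun_prop : Continuous fun r => y (r + h) - y r).intervalIntegrable _ _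
    refine IntervalIntegrable.const_mul ⟨?_, ?_⟩ _
    · exact h1.1.bdd_mul (measurable_gridSine hg.measurable).aestronglyMeasurable
        (ae_of_all _ (abs_gridSine_le hc))
    · exact h1.2.bdd_mul (measurable_gridSine hg.measurable).aestronglyMeasurable
        (ae_of_all _ (abs_gridSine_le hc))
  have hsum := intervalIntegral.sum_integral_adjacent_intervals (μ := volume)
    (a := fun j : ℕ => T + j * δ) (n := N) (f := fun r => h⁻¹ * (gridSine T δ N c σ g r *
      (y (r + h) - y r))) fun j _ => hint _ _
  simp only [Nat.cast_zero, zero_mul, add_zero] at hsum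
  rw [← hsum, ← Finset.sum_sub_distrib]
  refine (Finset.abs_sum_le_sum_abs _ _).trans ?_
  refine (Finset.sum_le_card_nsmul _ _ (δ * (h⁻¹ * (3 * c * w ^ 2 / σ)) + 2 * (c * w))
    fun j hj => ?_).trans (by rw [Finset.card_range, nsmul_eq_mul])
  have hj := Finset.mem_range.1 hj
  have hle : T + (j : ℝ) * δ ≤ T + ((j + 1 : ℕ) : ℝ) * δ := by
    push_cast; linarith
  have hcell := abs_forward_integral_cell_sub_le hy hle hh hc hσ hw
  rw [show T + ((j + 1 : ℕ) : ℝ) * δ - (T + (j : ℝ) * δ) = δ by push_cast; ring] at hcell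
  refine le_trans (le_of_eq ?_) hcell
  congr 2
  rw [intervalIntegral.integral_of_le hle, intervalIntegral.integral_of_le hle,
    integral_Ioc_eq_integral_Ioo, integral_Ioc_eq_integral_Ioo]
  refine setIntegral_congr_fun measurableSet_Ioo fun r hr => ?_
  rw [gridSine_eq_of_mem_cell hδ hj ⟨hr.1.le, hr.2⟩]
  -- Beyond `t` the increment of the stopped path vanishes, so it does not matter that the sine
  -- still uses the unstopped path.
  rcases le_or_gt t r with h' | h'
  · have : y (r + h) - y r = 0 := by
      simp only [y]; rw [min_eq_right h', min_eq_right (by linarith), sub_self]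
    rw [this]; ring
  · have e1 : g r = y r := by simp only [y]; rw [min_eq_left h'.le]
    have e2 : g (T + j * δ) = y (T + j * δ) := by
      simp only [y]; rw [min_eq_left (by linarith [hr.1])]
    rw [e1, e2]

end Grid

/-! ### Delayed averages as primitives and their integrals. -/

section BackwardMean

/-- Backward moving average over a window of length `h`. -/
def backwardMean (h : ℝ) (v : ℝ → ℝ) (t : ℝ) : ℝ := h⁻¹ * ∫ r in (t - h)..t, v r

variable {h c t T S : ℝ} {v g : ℝ → ℝ}

theorem intervalIntegrable_of_measurable_of_bound (hv : Measurable v) (hc : ∀ r, |v r| ≤ c)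
    (a b : ℝ) : IntervalIntegrable v volume a b :=
  (intervalIntegrable_const (c := c)).mono_fun' hv.aestronglyMeasurable (ae_of_all _ hc)

theorem abs_backwardMean_le (hh : 0 < h) (hc : ∀ r, |v r| ≤ c) (t : ℝ) :
    |backwardMean h v t| ≤ c := by
  have := intervalIntegral.norm_integral_le_of_norm_le_const (a := t - h) (b := t) (C := c)
    (f := v) fun r _ => hc r
  rw [sub_sub_cancel, abs_of_pos hh, Real.norm_eq_abs] at this
  rw [backwardMean, abs_mul, abs_of_pos (by positivity : 0 < h⁻¹), inv_mul_le_iff₀ hh, mul_comm]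
  exact this

theorem continuous_backwardMean (hv : Measurable v) (hc : ∀ r, |v r| ≤ c) :
    Continuous (backwardMean h v) := by
  have hi := intervalIntegrable_of_measurable_of_bound hv hc
  have hp := intervalIntegral.continuous_primitive hi 0
  have e : backwardMean h v = fun t => h⁻¹ * ((∫ r in (0 : ℝ)..t, v r) - ∫ r in (0 : ℝ)..(t - h), v r) := by
    ext t
    rw [backwardMean, intervalIntegral.integral_interval_sub_left (hi _ _) (hi _ _)]
  rw [e]
  have := hp.comp (continuous_id.sub continuous_const : Continuous fun t : ℝ => t - h)
  exact continuous_const.mul (hp.sub this)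

theorem backwardMean_eq_primitive (hv : Measurable v) (hc : ∀ r, |v r| ≤ c) (hh : 0 < h)
    (h0 : ∀ r < 0, v r = 0) (ht : 0 ≤ t) :
    backwardMean h v t = ∫ u in Ioo 0 t, h⁻¹ * (v u - v (u - h)) := by
  have hi := intervalIntegrable_of_measurable_of_bound hv hc
  have hi' := intervalIntegrable_of_measurable_of_bound (v := fun u => v (u - h))
    (hv.comp (measurable_id.sub_const h)) (fun r => hc _)
  have hz : ∫ r in (-h)..0, v r = 0 := by
    rw [intervalIntegral.integral_of_le (by linarith), integral_Ioc_eq_integral_Ioo]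
    exact setIntegral_eq_zero_of_forall_eq_zero fun r hr => h0 r hr.2
  rw [← integral_Ioc_eq_integral_Ioo, ← intervalIntegral.integral_of_le ht,
    intervalIntegral.integral_const_mul, intervalIntegral.integral_sub (hi _ _) (hi' _ _),
    intervalIntegral.integral_comp_sub_right, zero_sub, backwardMean]
  have h1 := intervalIntegral.integral_add_adjacent_intervals (hi (-h) 0) (hi 0 t)
  have h2 := intervalIntegral.integral_add_adjacent_intervals (hi (-h) (t - h)) (hi (t - h) t)
  rw [hz] at h1
  linear_combination h⁻¹ * (h2 - h1)

/-- Integration by parts turns the integral against a moving average into a forward integral. -/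
theorem integral_density_eq_forward_integral (hg : Continuous g) (hv : Measurable v)
    (hc : ∀ r, |v r| ≤ c) (hT : 0 ≤ T) (hTS : T ≤ S) (hsupp : ∀ r ∉ Ico T S, v r = 0)
    (hh : 0 < h) :
    ∫ u in Ioo 0 t, h⁻¹ * (v u - v (u - h)) * (g t - g u) =
      ∫ r in T..S, h⁻¹ * (v r * (g (min (r + h) t) - g (min r t))) := by
  -- `D` vanishes for `u ≥ t` and `v` vanishes on the negative axis, so the integral extends to the
  -- whole line, where the shift by `h` can be moved from `v` to `D`.
  let D : ℝ → ℝ := fun u => g t - g (min u t)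
  have hD : Continuous D := by fun_prop
  have hDi : ∀ q, Integrable fun u => v u * D (u + q) := by
    intro q
    have e : (fun u => v u * D (u + q)) = (Icc T S).indicator fun u => v u * D (u + q) := by
      ext u
      by_cases hu : u ∈ Icc T S
      · rw [indicator_of_mem hu]
      · rw [indicator_of_notMem hu, hsupp u fun h => hu (Ico_subset_Icc_self h), zero_mul]
    rw [e, integrable_indicator_iff measurableSet_Icc]
    have : IntegrableOn (fun u => D (u + q)) (Icc T S) :=
      (by fun_prop : Continuous fun u => D (u + q)).integrableOn_Icc
    exact this.bdd_mul hv.aestronglyMeasurable (ae_of_all _ hc)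
  have i0 : Integrable fun u => v u * D u := by simpa using hDi 0
  have ih : Integrable fun u => v (u - h) * D u := by
    simpa using (hDi h).comp_sub_right h
  have e1 : ∫ u in Ioo 0 t, h⁻¹ * (v u - v (u - h)) * (g t - g u) =
      ∫ u, h⁻¹ * (v u * D u - v (u - h) * D u) := by
    rw [← integral_Ico_eq_integral_Ioo]
    have : ∫ u in Ico 0 t, h⁻¹ * (v u - v (u - h)) * (g t - g u) =
        ∫ u in Ico 0 t, h⁻¹ * (v u * D u - v (u - h) * D u) := by
      refine setIntegral_congr_fun measurableSet_Ico fun u hu => ?_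
      simp only [D]
      rw [min_eq_left hu.2.le]
      ring
    rw [this]
    refine setIntegral_eq_integral_of_forall_compl_eq_zero fun u hu => ?_
    rcases lt_or_ge u 0 with h' | h'
    · rw [hsupp u fun h => by linarith [h.1], hsupp (u - h) fun h => by linarith [h.1]]
      ring
    · have : t ≤ u := by
        by_contra h2
        exact hu ⟨h', not_le.1 h2⟩
      have : D u = 0 := by simp [D, min_eq_right this]
      rw [this]
      ring
  have e2 : ∫ u, v (u - h) * D u = ∫ u, v u * D (u + h) := by
    have := integral_sub_right_eq_self (fun u => v u * D (u + h)) h (μ := volume)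
    simpa using this
  rw [e1, integral_const_mul, integral_sub i0 ih, e2, ← integral_sub i0 (hDi h),
    intervalIntegral.integral_const_mul, intervalIntegral.integral_of_le hTS,
    ← integral_Ico_eq_integral_Ioc]
  congr 1
  have e3 : ∀ u, v u * D u - v u * D (u + h) = v u * (g (min (u + h) t) - g (min u t)) := by
    intro u; simp only [D]; ring
  simp_rw [e3]
  exact (setIntegral_eq_integral_of_forall_compl_eq_zero fun u hu => by
    rw [hsupp u hu, zero_mul]).symm

end BackwardMean

/-- Moving averages of `gridSine` inherit measurability in a parameter. -/
theorem measurable_backwardMean_gridSine {α : Type*} [MeasurableSpace α] {Y : α → ℝ → ℝ}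
    (hY : ∀ a, Continuous (Y a)) (hm : ∀ r, Measurable fun a => Y a r) (T δ : ℝ) (N : ℕ)
    (c σ h t : ℝ) : Measurable fun a => backwardMean h (gridSine T δ N c σ (Y a)) t := by
  have hu : Measurable (Function.uncurry fun r a => Y a r) :=
    measurable_uncurry_of_continuous_of_measurable hY hm
  have h1 : Measurable fun p : α × ℝ => Y p.1 p.2 := hu.comp measurable_swap
  have h2 : Measurable fun p : α × ℝ => Y p.1 (T + ⌊(p.2 - T) / δ⌋₊ * δ) :=
    hu.comp (Measurable.prodMk (by fun_prop) measurable_fst)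
  have h3 : Measurable fun p : α × ℝ => gridSine T δ N c σ (Y p.1) p.2 := by
    have : (fun p : α × ℝ => gridSine T δ N c σ (Y p.1) p.2) =
        (Prod.snd ⁻¹' Ico T (T + N * δ)).indicator fun p : α × ℝ =>
          c * Real.sin ((Y p.1 p.2 - Y p.1 (T + ⌊(p.2 - T) / δ⌋₊ * δ)) / σ) := by
      ext p; rfl
    rw [this]
    refine Measurable.indicator ?_ (measurable_snd measurableSet_Ico)
    fun_prop
  unfold backwardMean
  simp only [intervalIntegral]
  have h4 : ∀ a b : ℝ, Measurable fun x => ∫ r in Ioc a b, gridSine T δ N c σ (Y x) r := fun a b =>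
    h3.stronglyMeasurable.integral_prod_right'.measurable
  exact ((h4 _ _).sub (h4 _ _)).const_mul _

end

/-! ### Block construction and pathwise divergence. -/

noncomputable section

/-- Left end `1 - 2⁻ᵏ` of the `k`-th dyadic block of `[0,1)`. -/
def blockStart (k : ℕ) : ℝ := 1 - (1 / 2) ^ k

/-- Length of a cell when the `k`-th block is divided into `N k` equal cells. -/
def cellLength (N : ℕ → ℕ) (k : ℕ) : ℝ := (1 / 2) ^ (k + 1) / N k

/-- The sine of the normalised increments of `g` over the cells of the `k`-th block. -/
def blockSine (H : ℝ) (N : ℕ → ℕ) (g : ℝ → ℝ) (k : ℕ) : ℝ → ℝ :=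
  gridSine (blockStart k) (cellLength N k) (N k) ((1 / 2) ^ (k + 1)) (cellLength N k ^ H) g

/-- The superposition of the delayed block integrands, the `k`-th one averaged over a window of
length `h k`. -/
def delayedIntegrand (H : ℝ) (N : ℕ → ℕ) (h : ℕ → ℝ) (g : ℝ → ℝ) (t : ℝ) : ℝ :=
  ∑' k, backwardMean (h k) (blockSine H N g k) t

/-- Accumulated truncated increments of `g` over the cells of the `k`-th block. -/
def blockVariation (H : ℝ) (N : ℕ → ℕ) (g : ℝ → ℝ) (k : ℕ) : ℝ :=
  ∑ j ∈ Finset.range (N k), (1 - Real.cos ((g (blockStart k + (j + 1 : ℕ) * cellLength N k) -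
    g (blockStart k + j * cellLength N k)) / cellLength N k ^ H))

/-- The number of cells `N k` is so large that the expected gain of the `k`-th block is bounded below
and fluctuations are summable; the window `h k` is so short that the delay is negligible. -/
structure IsBlockScheme (H lam : ℝ) (N : ℕ → ℕ) (h : ℕ → ℝ) : Prop where
  cells_pos : ∀ k, 0 < N k
  cells_rpow_le : ∀ k, (N k : ℝ) ^ (2 * H - 2) ≤ (1 / 2) ^ k
  one_le_gain : ∀ k, 1 ≤ (1 / 2) ^ (k + 1) * cellLength N k ^ H * N k
  window_pos : ∀ k, 0 < h k
  window_rpow_le : ∀ k, h k ^ (2 * lam - 1) ≤ cellLength N k ^ H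
  cells_mul_window_rpow_le : ∀ k, N k * h k ^ lam ≤ 1

/-- For fixed `k` the gain is a positive constant times `n^(1-H)` and the fluctuation is `n^(2H-2)`,
so a large `n` serves both. The window comes afterwards: its powers `2 * lam - 1` and `lam` are
positive. -/
theorem exists_isBlockScheme {H lam : ℝ} (h0 : 0 < H) (h1 : H < 1) (hl : 1 / 2 < lam) :
    ∃ N h, IsBlockScheme H lam N h := by
  have hN : ∀ k : ℕ, ∃ n : ℕ, 0 < n ∧ (n : ℝ) ^ (2 * H - 2) ≤ (1 / 2) ^ k ∧
      1 ≤ (1 / 2 : ℝ) ^ (k + 1) * ((1 / 2 : ℝ) ^ (k + 1) / n) ^ H * n := by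
    intro k
    have t1 : Tendsto (fun n : ℕ => (n : ℝ) ^ (2 * H - 2)) atTop (𝓝 0) := by
      have := (tendsto_rpow_neg_atTop (y := 2 - 2 * H) (by linarith)).comp
        (tendsto_natCast_atTop_atTop (R := ℝ))
      refine this.congr fun n => ?_
      simp only [Function.comp_apply]
      congr 1
      ring
    set b : ℝ := (1 / 2) ^ (k + 1) with hb
    have hb0 : 0 < b := by positivity
    have t2 : Tendsto (fun n : ℕ => b * b ^ H * (n : ℝ) ^ (1 - H)) atTop atTop :=
      ((tendsto_rpow_atTop (by linarith : 0 < 1 - H)).comp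
        tendsto_natCast_atTop_atTop).const_mul_atTop (by positivity)
    obtain ⟨n, hn1, hn2, hn3⟩ := ((t1.eventually_le_const
      (by positivity : (0 : ℝ) < (1 / 2) ^ k)).and ((t2.eventually_ge_atTop 1).and
        (eventually_gt_atTop 0))).exists
    have hn0 : (0 : ℝ) < n := by exact_mod_cast hn3
    refine ⟨n, hn3, hn1, hn2.trans (le_of_eq ?_)⟩
    rw [Real.div_rpow hb0.le hn0.le, Real.rpow_sub hn0, Real.rpow_one]
    field_simp
  choose N hN0 hN1 hN2 using hN
  have hh : ∀ k : ℕ, ∃ x : ℝ, 0 < x ∧ x ^ (2 * lam - 1) ≤ cellLength N k ^ H ∧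
      N k * x ^ lam ≤ 1 := by
    intro k
    have t : ∀ p : ℝ, 0 < p → Tendsto (fun x : ℝ => x ^ p) (𝓝[>] 0) (𝓝 0) := fun p hp => by
      have : ContinuousAt (fun x : ℝ => x ^ p) 0 := Real.continuousAt_rpow_const 0 p (Or.inr hp.le)
      rw [ContinuousAt, Real.zero_rpow hp.ne'] at this
      exact this.mono_left nhdsWithin_le_nhds
    have hNk : (0 : ℝ) < N k := by exact_mod_cast hN0 k
    have t2 := (t lam (by linarith)).const_mul (N k : ℝ)
    rw [mul_zero] at t2
    have hc : 0 < cellLength N k ^ H := by unfold cellLength; positivity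
    obtain ⟨x, hx1, hx2, hx3⟩ := (((t (2 * lam - 1) (by linarith)).eventually_le_const hc).and
      ((t2.eventually_le_const one_pos).and self_mem_nhdsWithin)).exists
    exact ⟨x, hx3, hx1, hx2⟩
  choose h hh0 hh1 hh2 using hh
  exact ⟨N, h, ⟨hN0, hN1, hN2, hh0, hh1, hh2⟩⟩

theorem hasSum_half_pow_succ : HasSum (fun k : ℕ => (1 / 2 : ℝ) ^ (k + 1)) 1 := by
  have := hasSum_geometric_two.mul_left (1 / 2 : ℝ)
  norm_num at this
  simpa [pow_succ, mul_comm] using this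

theorem blockStart_nonneg (k : ℕ) : 0 ≤ blockStart k := by
  have : (1 / 2 : ℝ) ^ k ≤ 1 := pow_le_one₀ (by norm_num) (by norm_num)
  unfold blockStart; linarith

theorem blockStart_le_one (k : ℕ) : blockStart k ≤ 1 := by
  have : (0 : ℝ) < (1 / 2) ^ k := by positivity
  unfold blockStart; linarith

theorem blockStart_mono : Monotone blockStart := by
  intro a b hab
  have : (1 / 2 : ℝ) ^ b ≤ (1 / 2) ^ a := pow_le_pow_of_le_one (by norm_num) (by norm_num) hab
  unfold blockStart; linarith

theorem tendsto_blockStart : Tendsto blockStart atTop (𝓝 1) := by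
  have := (tendsto_pow_atTop_nhds_zero_of_lt_one (r := (1 / 2 : ℝ)) (by norm_num)
    (by norm_num)).const_sub 1
  rwa [sub_zero] at this

namespace IsBlockScheme

variable {H lam C t : ℝ} {N : ℕ → ℕ} {h : ℕ → ℝ} {g : ℝ → ℝ}

theorem cellLength_pos (hS : IsBlockScheme H lam N h) (k : ℕ) : 0 < cellLength N k := by
  have : (0 : ℝ) < N k := by exact_mod_cast hS.cells_pos k
  unfold cellLength; positivity

theorem cells_mul_cellLength (hS : IsBlockScheme H lam N h) (k : ℕ) :
    N k * cellLength N k = (1 / 2) ^ (k + 1) := by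
  have : (0 : ℝ) < N k := by exact_mod_cast hS.cells_pos k
  unfold cellLength; field_simp

theorem blockStart_add (hS : IsBlockScheme H lam N h) (k : ℕ) :
    blockStart k + N k * cellLength N k = blockStart (k + 1) := by
  rw [hS.cells_mul_cellLength, blockStart, blockStart, pow_succ]; ring

theorem abs_blockSine_le (g : ℝ → ℝ) (k : ℕ) (r : ℝ) :
    |blockSine H N g k r| ≤ (1 / 2) ^ (k + 1) :=
  abs_gridSine_le (by positivity) r

theorem measurable_blockSine (hg : Continuous g) (k : ℕ) : Measurable (blockSine H N g k) :=
  measurable_gridSine hg.measurable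

theorem abs_term_le (hS : IsBlockScheme H lam N h) (g : ℝ → ℝ) (k : ℕ) (t : ℝ) :
    ‖backwardMean (h k) (blockSine H N g k) t‖ ≤ (1 / 2) ^ (k + 1) :=
  abs_backwardMean_le (hS.window_pos k) (abs_blockSine_le g k) t

theorem abs_delayedIntegrand_le (hS : IsBlockScheme H lam N h) (g : ℝ → ℝ) (t : ℝ) :
    |delayedIntegrand H N h g t| ≤ 1 :=
  tsum_of_norm_bounded hasSum_half_pow_succ fun k => hS.abs_term_le g k t

theorem continuous_delayedIntegrand (hS : IsBlockScheme H lam N h) (hg : Continuous g) :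
    Continuous (delayedIntegrand H N h g) :=
  continuous_tsum (fun k => continuous_backwardMean (measurable_blockSine hg k)
    (abs_blockSine_le g k)) hasSum_half_pow_succ.summable fun k t => hS.abs_term_le g k t

theorem blockSine_of_lt {k : ℕ} {r : ℝ} (hr : r < blockStart k) : blockSine H N g k r = 0 :=
  gridSine_of_lt hr

theorem backwardMean_blockSine (hS : IsBlockScheme H lam N h) (hg : Continuous g) (k : ℕ)
    (ht : 0 ≤ t) : backwardMean (h k) (blockSine H N g k) t =
      ∫ u in Ioo 0 t, (h k)⁻¹ * (blockSine H N g k u - blockSine H N g k (u - h k)) :=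
  backwardMean_eq_primitive (measurable_blockSine hg k) (abs_blockSine_le g k) (hS.window_pos k)
    (fun _ hr => blockSine_of_lt (hr.trans_le (blockStart_nonneg k))) ht

theorem backwardMean_blockSine_eq_zero (hS : IsBlockScheme H lam N h) (hg : Continuous g) {k : ℕ}
    (ht : 0 ≤ t) (htk : t ≤ blockStart k) : backwardMean (h k) (blockSine H N g k) t = 0 := by
  rw [hS.backwardMean_blockSine hg k ht]
  refine setIntegral_eq_zero_of_forall_eq_zero fun u hu => ?_
  have := hS.window_pos k
  rw [blockSine_of_lt (by linarith [hu.2]), blockSine_of_lt (by linarith [hu.2]), sub_self,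
    mul_zero]

theorem delayedIntegrand_zero (hS : IsBlockScheme H lam N h) (hg : Continuous g) :
    delayedIntegrand H N h g 0 = 0 := by
  unfold delayedIntegrand
  simp_rw [hS.backwardMean_blockSine_eq_zero hg le_rfl (blockStart_nonneg _)]
  exact tsum_zero

/-- Density of the delayed integrand before the `K`-th block. -/
def density (H : ℝ) (N : ℕ → ℕ) (h : ℕ → ℝ) (g : ℝ → ℝ) (K : ℕ) (u : ℝ) : ℝ :=
  ∑ k ∈ Finset.range K, (h k)⁻¹ * (blockSine H N g k u - blockSine H N g k (u - h k))

theorem measurable_term (hg : Continuous g) (k : ℕ) :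
    Measurable fun u => (h k)⁻¹ * (blockSine H N g k u - blockSine H N g k (u - h k)) := by
  have := measurable_blockSine (H := H) (N := N) hg k
  fun_prop

theorem measurable_density (hg : Continuous g) (K : ℕ) : Measurable (density H N h g K) := by
  unfold density
  exact Finset.measurable_sum _ fun k _ => measurable_term hg k

theorem abs_density_term_le (hS : IsBlockScheme H lam N h) (g : ℝ → ℝ) (k : ℕ) (u : ℝ) :
    |(h k)⁻¹ * (blockSine H N g k u - blockSine H N g k (u - h k))| ≤ (h k)⁻¹ * 2 := by
  rw [abs_mul, abs_of_pos (inv_pos.2 (hS.window_pos k))]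
  refine mul_le_mul_of_nonneg_left ?_ (inv_pos.2 (hS.window_pos k)).le
  have h1 := abs_blockSine_le (H := H) (N := N) g k u
  have h2 := abs_blockSine_le (H := H) (N := N) g k (u - h k)
  have h3 : (1 / 2 : ℝ) ^ (k + 1) ≤ 1 := pow_le_one₀ (by norm_num) (by norm_num)
  exact (abs_sub _ _).trans (by linarith)

theorem abs_density_le (hS : IsBlockScheme H lam N h) (g : ℝ → ℝ) (K : ℕ) (u : ℝ) :
    |density H N h g K u| ≤ ∑ k ∈ Finset.range K, (h k)⁻¹ * 2 :=
  (Finset.abs_sum_le_sum_abs _ _).trans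
    (Finset.sum_le_sum fun k _ => hS.abs_density_term_le g k u)

/-- Up to `blockStart K` no block from the `K`-th on has begun, and averages look only backwards, so
the series is a finite sum. -/
theorem delayedIntegrand_eq_primitive (hS : IsBlockScheme H lam N h) (hg : Continuous g) {K : ℕ}
    (ht : 0 ≤ t) (htK : t ≤ blockStart K) :
    delayedIntegrand H N h g t = ∫ u in Ioo 0 t, density H N h g K u := by
  unfold delayedIntegrand density
  rw [tsum_eq_sum (s := Finset.range K) fun k hk => hS.backwardMean_blockSine_eq_zero hg ht
    (htK.trans (blockStart_mono (by simpa using hk))), integral_finsetSum]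
  · exact Finset.sum_congr rfl fun k _ => hS.backwardMean_blockSine hg k ht
  · exact fun k _ => Measure.integrableOn_of_bounded (M := (h k)⁻¹ * 2) (by simp)
      (measurable_term hg k).aestronglyMeasurable
      (ae_of_all _ fun u => hS.abs_density_term_le g k u)

/-- Forward integral over the `k`-th block of the path stopped at `t`. -/
def blockIntegral (H : ℝ) (N : ℕ → ℕ) (h : ℕ → ℝ) (g : ℝ → ℝ) (t : ℝ) (k : ℕ) : ℝ :=
  ∫ r in (blockStart k)..(blockStart k + N k * cellLength N k),
    (h k)⁻¹ * (blockSine H N g k r * (g (min (r + h k) t) - g (min r t)))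

/-- The Hölder order `mu` is adapted to `β`, whereas `lam` belongs to the scheme, which is fixed
before `β`. -/
theorem gls_delayedIntegrand (hS : IsBlockScheme H lam N h) {β mu : ℝ} (h0 : 0 < β) (h1 : β < 1)
    (hmu : 1 - β < mu) (hC : 0 ≤ C) (hgc : Continuous g)
    (hg : ∀ x y, |g x - g y| ≤ C * |x - y| ^ mu) {φ : ℝ → ℝ}
    (hφ : ∀ x ∈ Icc 0 1, φ x = delayedIntegrand H N h g x) {K : ℕ} (htK : t ≤ blockStart K) :
    glsNorm β φ 0 t < ∞ ∧ GLSIntegrable β φ g 0 t ∧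
      glsIntegral β φ g 0 t = ∑ k ∈ Finset.range K, blockIntegral H N h g t k := by
  have hp : ∀ x ∈ Icc 0 t, φ x = ∫ u in Ioo 0 x, density H N h g K u := fun x hx => by
    rw [hφ x ⟨hx.1, hx.2.trans (htK.trans (blockStart_le_one K))⟩,
      hS.delayedIntegrand_eq_primitive hgc hx.1 (hx.2.trans htK)]
  have hm := measurable_density (H := H) (N := N) (h := h) hgc K
  obtain ⟨i1, i2⟩ := gls_of_primitive h0 h1 hmu hC hgc hg hm (hS.abs_density_le g K) hp
  refine ⟨glsNorm_lt_top_of_primitive h1 hm (hS.abs_density_le g K) hp, i1, ?_⟩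
  rw [i2]
  simp only [density, Finset.sum_mul]
  rw [integral_finsetSum]
  · refine Finset.sum_congr rfl fun k _ => ?_
    have hle : blockStart k ≤ blockStart k + N k * cellLength N k :=
      le_add_of_nonneg_right (mul_nonneg (Nat.cast_nonneg _) (hS.cellLength_pos k).le)
    exact integral_density_eq_forward_integral hgc (measurable_blockSine hgc k)
      (abs_blockSine_le g k) (blockStart_nonneg k) hle
      (fun r hr => by unfold blockSine gridSine; exact indicator_of_notMem hr _) (hS.window_pos k)
  · intro k _
    have : IntegrableOn (fun u => g t - g u) (Ioo 0 t) :=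
      (by fun_prop : Continuous fun u => g t - g u).integrableOn_Icc.mono_set Ioo_subset_Icc_self
    exact this.bdd_mul (measurable_term hgc k).aestronglyMeasurable
      (ae_of_all _ fun u => hS.abs_density_term_le g k u)

/-- The Taylor error is of order `h^(2 lam - 1) / σ` and the endpoint errors of order `N h^lam`. The
scheme bounds both, so the total loss is the summable amplitude times a constant of the path,
uniformly in `t`. -/
theorem sum_le_blockIntegral (hS : IsBlockScheme H lam N h) (hl : 1 / 2 < lam) (hC : 0 ≤ C)
    (hgc : Continuous g) (hg : ∀ x y, |g x - g y| ≤ C * |x - y| ^ lam) (k : ℕ) :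
    ∑ j ∈ Finset.range (N k), (1 / 2) ^ (k + 1) * cellLength N k ^ H * (1 - Real.cos
      ((g (min (blockStart k + (j + 1 : ℕ) * cellLength N k) t) -
        g (min (blockStart k + j * cellLength N k) t)) / cellLength N k ^ H)) -
      (1 / 2) ^ (k + 1) * (3 * C ^ 2 + 2 * C) ≤ blockIntegral H N h g t k := by
  have hh := hS.window_pos k
  have hσ : 0 < cellLength N k ^ H := Real.rpow_pos_of_pos (hS.cellLength_pos k) _
  have hw : ∀ r, ∀ q ∈ Icc 0 (h k), |g (min (r + q) t) - g (min r t)| ≤ C * h k ^ lam := by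
    intro r q hq
    refine (hg _ _).trans (mul_le_mul_of_nonneg_left (Real.rpow_le_rpow (abs_nonneg _) ?_
      (by linarith)) hC)
    have := abs_min_sub_min_le_max (r + q) t r t
    rw [add_sub_cancel_left, sub_self, abs_zero, max_eq_left (abs_nonneg _),
      abs_of_nonneg hq.1] at this
    exact this.trans hq.2
  have key := abs_forward_integral_grid_sub_le (T := blockStart k) (N := N k) (t := t)
    (c := (1 / 2) ^ (k + 1)) hgc (hS.cellLength_pos k) hh (by positivity) hσ hw
  have err : N k * (cellLength N k * ((h k)⁻¹ * (3 * (1 / 2) ^ (k + 1) * (C * h k ^ lam) ^ 2 /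
      cellLength N k ^ H)) + 2 * ((1 / 2) ^ (k + 1) * (C * h k ^ lam))) ≤
      (1 / 2) ^ (k + 1) * (3 * C ^ 2 + 2 * C) := by
    have a1 : (N k : ℝ) * cellLength N k ≤ 1 := by
      rw [hS.cells_mul_cellLength]; exact pow_le_one₀ (by norm_num) (by norm_num)
    have a0 : 0 ≤ (N k : ℝ) * cellLength N k :=
      mul_nonneg (Nat.cast_nonneg _) (hS.cellLength_pos k).le
    have a2 : (h k)⁻¹ * (h k ^ lam) ^ 2 / cellLength N k ^ H ≤ 1 := by
      rw [div_le_one hσ]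
      refine le_trans (le_of_eq ?_) (hS.window_rpow_le k)
      rw [← Real.rpow_mul_natCast hh.le, ← Real.rpow_neg_one, ← Real.rpow_add hh]
      congr 1
      push_cast
      ring
    have a3 : 0 ≤ (h k)⁻¹ * (h k ^ lam) ^ 2 / cellLength N k ^ H := by positivity
    have a4 := mul_le_one₀ a1 a3 a2
    have a5 := hS.cells_mul_window_rpow_le k
    calc _ = (1 / 2) ^ (k + 1) * (3 * C ^ 2 * (N k * cellLength N k * ((h k)⁻¹ *
          (h k ^ lam) ^ 2 / cellLength N k ^ H)) + 2 * C * (N k * h k ^ lam)) := by ring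
      _ ≤ (1 / 2) ^ (k + 1) * (3 * C ^ 2 * 1 + 2 * C * 1) := by gcongr
      _ = _ := by ring
  have k1 := (abs_le.1 (key.trans err)).1
  have k2 : blockIntegral H N h g t k = ∫ r in (blockStart k)..(blockStart k + N k *
    cellLength N k), (h k)⁻¹ * (gridSine (blockStart k) (cellLength N k) (N k)
      ((1 / 2) ^ (k + 1)) (cellLength N k ^ H) g r * (g (min (r + h k) t) - g (min r t))) := rfl
  linarith

/-- Unfinished or unlucky blocks lose no more than the error, since every cell gain is nonnegative.
-/
theorem neg_le_blockIntegral (hS : IsBlockScheme H lam N h) (hl : 1 / 2 < lam) (hC : 0 ≤ C)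
    (hgc : Continuous g) (hg : ∀ x y, |g x - g y| ≤ C * |x - y| ^ lam) (k : ℕ) :
    -((1 / 2) ^ (k + 1) * (3 * C ^ 2 + 2 * C)) ≤ blockIntegral H N h g t k := by
  have hσ : 0 < cellLength N k ^ H := Real.rpow_pos_of_pos (hS.cellLength_pos k) _
  refine le_trans ?_ (hS.sum_le_blockIntegral hl hC hgc hg k)
  rw [neg_eq_zero_sub]
  refine sub_le_sub_right (Finset.sum_nonneg fun j _ => mul_nonneg (by positivity) ?_) _
  linarith [Real.cos_le_one ((g (min (blockStart k + (j + 1 : ℕ) * cellLength N k) t) -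
        g (min (blockStart k + j * cellLength N k) t)) / cellLength N k ^ H)]

theorem gain_le_blockIntegral (hS : IsBlockScheme H lam N h) (hl : 1 / 2 < lam) (hC : 0 ≤ C)
    (hgc : Continuous g) (hg : ∀ x y, |g x - g y| ≤ C * |x - y| ^ lam) {k : ℕ}
    (ht : blockStart (k + 1) ≤ t) :
    (1 / 2) ^ (k + 1) * cellLength N k ^ H * blockVariation H N g k -
      (1 / 2) ^ (k + 1) * (3 * C ^ 2 + 2 * C) ≤ blockIntegral H N h g t k := by
  refine le_trans (le_of_eq ?_) (hS.sum_le_blockIntegral hl hC hgc hg k)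
  rw [blockVariation, Finset.mul_sum]
  congr 1
  refine Finset.sum_congr rfl fun j hj => ?_
  have hm : ∀ i : ℕ, i ≤ N k → blockStart k + i * cellLength N k ≤ t := by
    intro i hi
    rw [← hS.blockStart_add] at ht
    have : (i : ℝ) ≤ N k := by exact_mod_cast hi
    have := mul_le_mul_of_nonneg_right this (hS.cellLength_pos k).le
    linarith
  have hj := Finset.mem_range.1 hj
  rw [min_eq_left (hm (j + 1) hj), min_eq_left (hm j hj.le)]

/-- The pathwise integral diverges when all but finitely many blocks have a large variation. -/
theorem tendsto_glsIntegral (hS : IsBlockScheme H lam N h) (hl : 1 / 2 < lam) (hC : 0 ≤ C)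
    (hgc : Continuous g) (hg : ∀ x y, |g x - g y| ≤ C * |x - y| ^ lam)
    (hV : ∀ᶠ k in atTop, (N k : ℝ) / 6 ≤ blockVariation H N g k) {I : ℝ → ℝ}
    (hI : ∀ t K, t ≤ blockStart K → I t = ∑ k ∈ Finset.range K, blockIntegral H N h g t k) :
    Tendsto I (𝓝[<] 1) atTop := by
  set R := 3 * C ^ 2 + 2 * C with hR
  have hR0 : 0 ≤ R := by positivity
  obtain ⟨k₀, hk₀⟩ := eventually_atTop.1 hV
  rw [tendsto_atTop]
  intro A
  -- Each of `n` completed good blocks gains at least `1/6`, and all losses together are at most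
  -- `R`.
  obtain ⟨n, hn⟩ := exists_nat_ge (6 * (A + R))
  have hev : ∀ᶠ t in 𝓝[<] (1 : ℝ), blockStart (k₀ + n) ≤ t := by
    have : blockStart (k₀ + n) < 1 := by
      have : (0 : ℝ) < (1 / 2) ^ (k₀ + n) := by positivity
      unfold blockStart; linarith
    exact (eventually_ge_nhds this).filter_mono nhdsWithin_le_nhds
  filter_upwards [hev, self_mem_nhdsWithin] with t ht ht1
  -- `K` depends on `t`; the lower bound does not, because the losses are summable over all blocks.
  obtain ⟨K, hK, hKn⟩ := ((tendsto_blockStart.eventually_const_le (show t < 1 from ht1)).and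
    (eventually_ge_atTop (k₀ + n))).exists
  rw [hI t K hK]
  have hterm : ∀ k ∈ Finset.range K, (if k ∈ Finset.Ico k₀ (k₀ + n) then (1 / 6 : ℝ) else 0) -
      (1 / 2) ^ (k + 1) * R ≤ blockIntegral H N h g t k := by
    intro k _
    split_ifs with hk
    · have hk := Finset.mem_Ico.1 hk
      refine le_trans ?_ (hS.gain_le_blockIntegral hl hC hgc hg
        ((blockStart_mono (by omega : k + 1 ≤ k₀ + n)).trans ht))
      refine sub_le_sub_right ?_ _
      have g1 := hS.one_le_gain k
      have g2 := hk₀ k hk.1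
      have hσ : 0 < cellLength N k ^ H := Real.rpow_pos_of_pos (hS.cellLength_pos k) _
      calc (1 / 6 : ℝ) ≤ (1 / 2) ^ (k + 1) * cellLength N k ^ H * (N k / 6) := by linarith
        _ ≤ _ := by gcongr
    · rw [zero_sub]
      exact hS.neg_le_blockIntegral hl hC hgc hg k
  refine le_trans ?_ (Finset.sum_le_sum hterm)
  rw [Finset.sum_sub_distrib, ← Finset.sum_mul, ← Finset.sum_filter, Finset.filter_mem_eq_inter,
    Finset.inter_eq_right.2 (fun k hk => Finset.mem_range.2 ((Finset.mem_Ico.1 hk).2.trans_le hKn))]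
  have hsum : ∑ k ∈ Finset.range K, (1 / 2 : ℝ) ^ (k + 1) ≤ 1 :=
    sum_le_hasSum _ (fun k _ => by positivity) hasSum_half_pow_succ
  simp only [Finset.sum_const, Nat.card_Ico, add_tsub_cancel_left, nsmul_eq_mul]
  nlinarith

end IsBlockScheme

theorem measurable_tsum_of_summable {α : Type*} [MeasurableSpace α] {f : ℕ → α → ℝ}
    (hf : ∀ k, Measurable (f k)) (hs : ∀ a, Summable fun k => f k a) :
    Measurable fun a => ∑' k, f k a :=
  measurable_of_tendsto_metrizable
    (f := fun n a => ∑ k ∈ Finset.range n, f k a)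
    (fun _ => Finset.measurable_sum _ fun k _ => hf k)
    (tendsto_pi_nhds.2 fun a => (hs a).hasSum.tendsto_sum_nat)

/-! ### Almost sure gains and adaptedness. -/

namespace IsFractionalBrownianMotion

variable {Ω : Type*} {m : MeasurableSpace Ω} {P : Measure Ω}
  {ℱ : Filtration (Icc (0 : ℝ) 1) m} {H lam : ℝ} {B : Icc (0 : ℝ) 1 → Ω → ℝ}
  {N : ℕ → ℕ} {h : ℕ → ℝ}

/-- Borel–Cantelli: the scheme makes the failure probabilities at most `36 * 2^(-k)`. -/
theorem ae_eventually_le_blockVariation [IsProbabilityMeasure P]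
    (hB : IsFractionalBrownianMotion P ℱ H B) (hH : 1 / 2 ≤ H) (hS : IsBlockScheme H lam N h) :
    ∀ᵐ ω ∂P, ∀ᶠ k in atTop, (N k : ℝ) / 6 ≤ blockVariation H N (samplePath B ω) k := by
  have hle : ∀ k, P {ω | blockVariation H N (samplePath B ω) k < N k / 6} ≤
      ENNReal.ofReal (36 * (1 / 2) ^ k) := by
    intro k
    rw [← ofReal_measureReal]
    refine ENNReal.ofReal_le_ofReal ((hB.measureReal_sum_one_sub_cos_lt hH (blockStart_nonneg k)
      (hS.cellLength_pos k) (hS.cells_pos k) ?_).trans ?_)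
    · rw [hS.blockStart_add]; exact blockStart_le_one _
    · exact mul_le_mul_of_nonneg_left (hS.cells_rpow_le k) (by norm_num)
  have hsum : ∑' k, P {ω | blockVariation H N (samplePath B ω) k < N k / 6} ≠ ∞ := by
    refine ne_top_of_le_ne_top ?_ (ENNReal.tsum_le_tsum hle)
    rw [← ENNReal.ofReal_tsum_of_nonneg (fun k => by positivity)
      ((summable_geometric_of_lt_one (by norm_num) (by norm_num)).mul_left _)]
    exact ENNReal.ofReal_ne_top
  filter_upwards [ae_eventually_notMem hsum] with ω hω
  filter_upwards [hω] with k hk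
  exact not_lt.1 hk

/-- The average at time `t` uses the cell integrand only up to `t`, so the path may be stopped at
`t`; every value of the stopped path is measurable with respect to `ℱ t`. -/
theorem measurable_delayedIntegrand (hB : IsFractionalBrownianMotion P ℱ H B)
    (hS : IsBlockScheme H lam N h) (t : Icc (0 : ℝ) 1) :
    Measurable[ℱ t] fun ω => delayedIntegrand H N h (samplePath B ω) t := by
  have hterm : ∀ k, Measurable[ℱ t] fun ω =>
      backwardMean (h k) (blockSine H N (samplePath B ω) k) t := by
    intro k
    have e : ∀ ω, backwardMean (h k) (blockSine H N (samplePath B ω) k) t =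
        backwardMean (h k) (gridSine (blockStart k) (cellLength N k) (N k) ((1 / 2) ^ (k + 1))
          (cellLength N k ^ H) fun x => samplePath B ω (min x t)) t := by
      intro ω
      have hle : (t : ℝ) - h k ≤ t := by linarith [hS.window_pos k]
      unfold backwardMean
      rw [intervalIntegral.integral_of_le hle, intervalIntegral.integral_of_le hle]
      congr 1
      refine setIntegral_congr_fun measurableSet_Ioc fun r hr => ?_
      exact (gridSine_comp_min (hS.cellLength_pos k) hr.2).symm
    simp_rw [e]
    refine @measurable_backwardMean_gridSine Ω (ℱ t) _ (fun ω => ?_) (fun r => ?_) _ _ _ _ _ _ _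
    · have := hB.continuous_samplePath ω
      fun_prop
    · have hle : projIcc (0 : ℝ) 1 zero_le_one (min r t) ≤ t := by
        rw [← Subtype.coe_le_coe, coe_projIcc]
        exact max_le t.2.1 ((min_le_right _ _).trans (min_le_right _ _))
      exact (hB.adapted _).mono (ℱ.mono hle) le_rfl
  exact @measurable_tsum_of_summable Ω (ℱ t) _ hterm fun ω =>
    Summable.of_norm_bounded hasSum_half_pow_succ.summable
      fun k => hS.abs_term_le (samplePath B ω) k t

end IsFractionalBrownianMotion

end

theorem mainTheorem2 {Ω : Type*} {m : MeasurableSpace Ω} (P : Measure Ω) [IsProbabilityMeasure P]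
    (ℱ : Filtration (Icc (0 : ℝ) 1) m) (H : ℝ) (hH : 1 / 2 < H) (hH1 : H < 1)
    (B : Icc (0 : ℝ) 1 → Ω → ℝ) (hB : IsFractionalBrownianMotion P ℱ H B)
    (η : ℝ) (hη : 0 < η) (hηH : η < 1 / H - 1) :
    ∃ φ : Icc (0 : ℝ) 1 → Ω → ℝ,
      Adapted ℱ φ ∧
      (∀ ω, Continuous fun t => φ t ω) ∧
      (∀ ω, φ 0 ω = 0) ∧
      (∀ t ω, |φ t ω| ≤ 1 + η) ∧
      ∀ β : ℝ, 1 - H < β → β < 1 / 2 → ∀ᵐ ω ∂P,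
        (∀ t : ℝ, 0 ≤ t → t < 1 →
          glsNorm β (samplePath φ ω) 0 t < ∞ ∧
          GLSIntegrable β (samplePath φ ω) (samplePath B ω) 0 t) ∧
        Tendsto (fun t : ℝ => glsIntegral β (samplePath φ ω) (samplePath B ω) 0 t)
          (𝓝[<] 1) atTop := by
  -- One order in `(1/2, H)` governs the error estimates; `φ` is built from it without reference to
  -- `β`.
  obtain ⟨lam, hl, hlH⟩ := exists_between hH
  obtain ⟨N, h, hS⟩ := exists_isBlockScheme (by linarith : 0 < H) hH1 hl
  refine ⟨fun t ω => delayedIntegrand H N h (samplePath B ω) t,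
    fun t => hB.measurable_delayedIntegrand hS t,
    fun ω => (hS.continuous_delayedIntegrand (hB.continuous_samplePath ω)).comp
      continuous_subtype_val,
    fun ω => hS.delayedIntegrand_zero (hB.continuous_samplePath ω),
    fun t ω => (hS.abs_delayedIntegrand_le _ _).trans (by linarith), fun β hβ hβ2 => ?_⟩
  -- A second order, above `1 - β`, makes the integral of order `β` exist. Its value does not
  -- involve `β`, so divergence follows from the estimates with `lam`.
  obtain ⟨mu, hmu, hmuH⟩ := exists_between (by linarith : 1 - β < H)
  filter_upwards [hB.ae_holder (by linarith) hlH, hB.ae_holder (by linarith) hmuH,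
    hB.ae_eventually_le_blockVariation hH.le hS] with ω ⟨C, hC, hg⟩ ⟨D, hD, hg'⟩ hV
  have hφ : ∀ x ∈ Icc (0 : ℝ) 1, samplePath (fun (t : Icc (0 : ℝ) 1) ω =>
      delayedIntegrand H N h (samplePath B ω) t) ω x = delayedIntegrand H N h (samplePath B ω) x :=
    fun x hx => IccExtend_of_mem _ _ hx
  have key := fun (t : ℝ) (K : ℕ) (ht : t ≤ blockStart K) =>
    hS.gls_delayedIntegrand (by linarith) (by linarith) hmu hD (hB.continuous_samplePath ω) hg' hφ ht
  refine ⟨fun t _ ht => ?_, hS.tendsto_glsIntegral hl hC (hB.continuous_samplePath ω) hg hV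
    fun t K ht => (key t K ht).2.2⟩
  obtain ⟨K, hK⟩ := (tendsto_blockStart.eventually_const_le ht).exists
  exact ⟨(key t K hK).1, (key t K hK).2.1⟩
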